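/- All algebras are unital and over $\mathbb{C}$, and $\otimes=\otimes_{\mathbb C}$. Let $A$ be a Hopf algebra with bijective antipode, with coproduct $\Delta$ and counit $\varepsilon$. A \emph{quantum homogeneous $A$-space} is a subalgebra $B\subseteq A$ with $\Delta(B)\subseteq A\otimes B$ such that $A$ is faithfully flat as a right $B$-module (that is, $A\otimes_B-$ preserves and reflects exact sequences of left $B$-modules) and $B^+A=AB^+$, where $B^+:=B\cap\ker\varepsilon$. Write $\pi_B:A\to\pi_B(A):=A/B^+A$ for the quotient map; $\pi_B(A)$ carries the induced coalgebra structure. Let $B\subseteq P\subseteq A$ be a nested pair of quantum homogeneous $A$-spaces. Let ${}^A_B\mathrm{Mod}$ be the category of relative Hopf modules: left $A$-comodules $\mathcal F$ with a left $B$-module structure such that $\Delta_L(bf)=\Delta(b)\Delta_L(f)$; morphisms are the left $A$-comodule, left $B$-module maps. Let ${}^{\pi_B}\mathrm{Mod}$ be the category of left $\pi_B(A)$-comodules. Takeuchi's functors are $$\Phi(\mathcal F)=\mathcal F/B^+\mathcal F,\quad [f]\mapsto \pi_B(f_{(-1)})\otimes[f_{(0)}];\qquad \Psi(V)=A\,\square_{\pi_B(A)}V,$$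 where $A$ is a right $\pi_B(A)$-comodule via $(\mathrm{id}\otimes\pi_B)\Delta$, and $B$ and the left $A$-coaction of $\Psi(V)$ act on the first tensor factor; on morphisms $\Phi$ is the induced map on quotients and $\Psi(\gamma)=\mathrm{id}\otimes\gamma$. Takeuchi's unit and counit are the natural transformations $$\mathrm U_{\mathcal F}:\mathcal F\to\Psi\Phi(\mathcal F),\ f\mapsto f_{(-1)}\otimes[f_{(0)}],\qquad \mathrm C_V:\Phi\Psi(V)\to V,\ \Big[\sum_i a_i\otimes v_i\Big]\mapsto\sum_i\varepsilon(a_i)v_i .$$ Let ${}^A_B\mathrm{Mod}^{\pi_P}$ be the category of those $\mathcal F\in{}^A_B\mathrm{Mod}$ endowed with a right $\pi_P(A)$-coaction $\Delta_R:\mathcal F\to\mathcal F\otimes\pi_P(A)$ that makes $\mathcal F$ an $(A,\pi_P(A))$-bicomodule and is left $B$-linear ($B$ acting on the first factor of $\mathcal F\otimes\pi_P(A)$); morphisms are the $(A,\pi_P(A))$-bicomodule, left $B$-module maps. Let ${}^{\pi_B}\mathrm{Mod}^{\pi_P}$ be the category of $(\pi_B(A),\pi_P(A))$-bicomodules. The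 right $\pi_P(A)$-coactions $[f]\mapsto[f_{(0)}]\otimes f_{(1)}$ on $\Phi(\mathcal F)$ and $\mathrm{id}\otimes\Delta_R$ on $\Psi(V)$ lift $\Phi$ and $\Psi$ to functors, again denoted $$\Phi:{}^A_B\mathrm{Mod}^{\pi_P}\to{}^{\pi_B}\mathrm{Mod}^{\pi_P},\qquad \Psi:{}^{\pi_B}\mathrm{Mod}^{\pi_P}\to{}^A_B\mathrm{Mod}^{\pi_P},$$ which commute with the functors that forget the right coactions. \textbf{Proposition.} For every $\mathcal F\in{}^A_B\mathrm{Mod}^{\pi_P}$ and $V\in{}^{\pi_B}\mathrm{Mod}^{\pi_P}$ the maps $\mathrm U_{\mathcal F}$ and $\mathrm C_V$ are right $\pi_P(A)$-comodule maps. Moreover, with unit $\mathrm U$ and counit $\mathrm C$, the functors $\Phi$ and $\Psi$ form an adjoint equivalence between ${}^A_B\mathrm{Mod}^{\pi_P}$ and ${}^{\pi_B}\mathrm{Mod}^{\pi_P}$: $\Phi$ is left adjoint to $\Psi$ with unit $\mathrm U$ and counit $\mathrm C$, and both are natural isomorphisms. -/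

import Mathlib

open CategoryTheory
open scoped TensorProduct

universe u

set_option linter.unusedSectionVars false

noncomputable section

namespace NestedQHS

/-! ### Comodules and bicomodules -/

section Coactions

variable {C D C' : Type*} [AddCommMonoid C] [Module ℂ C] [Coalgebra ℂ C]
  [AddCommMonoid D] [Module ℂ D] [Coalgebra ℂ D]
  [AddCommMonoid C'] [Module ℂ C'] [Coalgebra ℂ C']
variable {M N : Type*} [AddCommMonoid M] [Module ℂ M] [AddCommMonoid N] [Module ℂ N]

/-- `ρ` is a coassociative and counital left coaction of the coalgebra `C` on `M`. -/
structure IsLeftCoaction (ρ : M →ₗ[ℂ] C ⊗[ℂ] M) : Prop where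
  coassoc : (TensorProduct.assoc ℂ C C M).toLinearMap ∘ₗ
    (Coalgebra.comul (R := ℂ) (A := C)).rTensor M ∘ₗ ρ = ρ.lTensor C ∘ₗ ρ
  counit : (Coalgebra.counit (R := ℂ) (A := C)).rTensor M ∘ₗ ρ = TensorProduct.mk ℂ ℂ M 1

/-- `ρ` is a coassociative and counital right coaction of the coalgebra `D` on `M`. -/
structure IsRightCoaction (ρ : M →ₗ[ℂ] M ⊗[ℂ] D) : Prop where
  coassoc : (TensorProduct.assoc ℂ M D D).toLinearMap ∘ₗ ρ.rTensor D ∘ₗ ρ =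
    (Coalgebra.comul (R := ℂ) (A := D)).lTensor M ∘ₗ ρ
  counit : (Coalgebra.counit (R := ℂ) (A := D)).lTensor M ∘ₗ ρ =
    (TensorProduct.mk ℂ M ℂ).flip 1

/-- The left coaction `l` and the right coaction `r` on `M` commute. -/
def CoactionsCommute (l : M →ₗ[ℂ] C ⊗[ℂ] M) (r : M →ₗ[ℂ] M ⊗[ℂ] D) : Prop :=
  (TensorProduct.assoc ℂ C M D).toLinearMap ∘ₗ l.rTensor D ∘ₗ r = r.lTensor C ∘ₗ l

theorem IsLeftCoaction.ofSurjective {ρ : M →ₗ[ℂ] C ⊗[ℂ] M} (h : IsLeftCoaction ρ)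
    (p : C →ₗc[ℂ] C') (q : M →ₗ[ℂ] N) (hq : Function.Surjective q)
    (σ : N →ₗ[ℂ] C' ⊗[ℂ] N) (hσ : σ ∘ₗ q = TensorProduct.map p.toLinearMap q ∘ₗ ρ) :
    IsLeftCoaction σ := by
  constructor
  · rw [← LinearMap.cancel_right hq]
    have e1 : (Coalgebra.comul (R := ℂ) (A := C')).rTensor N ∘ₗ
        TensorProduct.map p.toLinearMap q =
        TensorProduct.map (TensorProduct.map p.toLinearMap p.toLinearMap) q ∘ₗ
        (Coalgebra.comul (R := ℂ) (A := C)).rTensor M := by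
      ext c m
      simp
    have e2 : σ.lTensor C' ∘ₗ TensorProduct.map p.toLinearMap q =
        TensorProduct.map p.toLinearMap (TensorProduct.map p.toLinearMap q) ∘ₗ ρ.lTensor C := by
      ext c m
      have := LinearMap.congr_fun hσ m
      simp at this
      simp [this]
    have e3 : (TensorProduct.assoc ℂ C' C' N).toLinearMap ∘ₗ
        TensorProduct.map (TensorProduct.map p.toLinearMap p.toLinearMap) q =
        TensorProduct.map p.toLinearMap (TensorProduct.map p.toLinearMap q) ∘ₗ
        (TensorProduct.assoc ℂ C C M).toLinearMap := by
      ext; simp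
    have h' := h.coassoc
    simp only [LinearMap.ext_iff, LinearMap.comp_apply, LinearEquiv.coe_coe] at e1 e2 e3 hσ h'
    ext m
    simp only [LinearMap.comp_apply, LinearEquiv.coe_coe]
    rw [hσ, e1, e3, h', e2]
  · rw [← LinearMap.cancel_right hq, LinearMap.comp_assoc, hσ]
    have e1 : (Coalgebra.counit (R := ℂ) (A := C')).rTensor N ∘ₗ
        TensorProduct.map p.toLinearMap q = q.lTensor ℂ ∘ₗ
        (Coalgebra.counit (R := ℂ) (A := C)).rTensor M := by
      ext c m
      simp
    rw [← LinearMap.comp_assoc, e1, LinearMap.comp_assoc, h.counit]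
    ext; simp

theorem IsRightCoaction.ofSurjective {ρ : M →ₗ[ℂ] M ⊗[ℂ] D} (h : IsRightCoaction ρ)
    (q : M →ₗ[ℂ] N) (hq : Function.Surjective q)
    (σ : N →ₗ[ℂ] N ⊗[ℂ] D) (hσ : σ ∘ₗ q = q.rTensor D ∘ₗ ρ) :
    IsRightCoaction σ := by
  constructor
  · rw [← LinearMap.cancel_right hq]
    have e1 : (Coalgebra.comul (R := ℂ) (A := D)).lTensor N ∘ₗ q.rTensor D =
        q.rTensor (D ⊗[ℂ] D) ∘ₗ (Coalgebra.comul (R := ℂ) (A := D)).lTensor M := by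
      ext; simp
    have e2 : σ.rTensor D ∘ₗ q.rTensor D = (q.rTensor D).rTensor D ∘ₗ ρ.rTensor D := by
      rw [← LinearMap.rTensor_comp, hσ, LinearMap.rTensor_comp]
    have e3 : (TensorProduct.assoc ℂ N D D).toLinearMap ∘ₗ (q.rTensor D).rTensor D =
        q.rTensor (D ⊗[ℂ] D) ∘ₗ (TensorProduct.assoc ℂ M D D).toLinearMap := by
      ext; simp
    have h' := h.coassoc
    simp only [LinearMap.ext_iff, LinearMap.comp_apply, LinearEquiv.coe_coe] at e1 e2 e3 hσ h'
    ext m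
    simp only [LinearMap.comp_apply, LinearEquiv.coe_coe]
    rw [hσ, e2, e3, h', e1]
  · rw [← LinearMap.cancel_right hq, LinearMap.comp_assoc, hσ]
    have e1 : (Coalgebra.counit (R := ℂ) (A := D)).lTensor N ∘ₗ q.rTensor D =
        q.rTensor ℂ ∘ₗ (Coalgebra.counit (R := ℂ) (A := D)).lTensor M := by
      ext; simp
    rw [← LinearMap.comp_assoc, e1, LinearMap.comp_assoc, h.counit]
    ext; simp

theorem CoactionsCommute.ofSurjective {l : M →ₗ[ℂ] C ⊗[ℂ] M} {r : M →ₗ[ℂ] M ⊗[ℂ] D}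
    (h : CoactionsCommute l r) (p : C →ₗ[ℂ] C') (q : M →ₗ[ℂ] N) (hq : Function.Surjective q)
    (l' : N →ₗ[ℂ] C' ⊗[ℂ] N) (hl : l' ∘ₗ q = TensorProduct.map p q ∘ₗ l)
    (r' : N →ₗ[ℂ] N ⊗[ℂ] D) (hr : r' ∘ₗ q = q.rTensor D ∘ₗ r) :
    CoactionsCommute l' r' := by
  unfold CoactionsCommute at *
  rw [← LinearMap.cancel_right hq]
  have e1 : l'.rTensor D ∘ₗ q.rTensor D = (TensorProduct.map p q).rTensor D ∘ₗ l.rTensor D := by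
    rw [← LinearMap.rTensor_comp, hl, LinearMap.rTensor_comp]
  have e2 : (TensorProduct.assoc ℂ C' N D).toLinearMap ∘ₗ (TensorProduct.map p q).rTensor D =
      TensorProduct.map p (q.rTensor D) ∘ₗ (TensorProduct.assoc ℂ C M D).toLinearMap := by
    ext; simp
  have e3 : r'.lTensor C' ∘ₗ TensorProduct.map p q =
      TensorProduct.map p (q.rTensor D) ∘ₗ r.lTensor C := by
    rw [LinearMap.lTensor_comp_map, hr, LinearMap.map_comp_lTensor]
  simp only [LinearMap.ext_iff, LinearMap.comp_apply, LinearEquiv.coe_coe] at e1 e2 e3 hl hr h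
  ext m
  simp only [LinearMap.comp_apply, LinearEquiv.coe_coe]
  rw [hr, e1, e2, h, hl, e3]

theorem IsLeftCoaction.ofInjective [Module.Flat ℂ C] {ρ : M →ₗ[ℂ] C ⊗[ℂ] M} (h : IsLeftCoaction ρ)
    (i : N →ₗ[ℂ] M) (hi : Function.Injective i)
    (σ : N →ₗ[ℂ] C ⊗[ℂ] N) (hσ : i.lTensor C ∘ₗ σ = ρ ∘ₗ i) :
    IsLeftCoaction σ := by
  constructor
  · rw [← LinearMap.cancel_left (f := (i.lTensor C).lTensor C)
      (Module.Flat.lTensor_preserves_injective_linearMap _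
        (Module.Flat.lTensor_preserves_injective_linearMap _ hi))]
    have e1 : (i.lTensor C).lTensor C ∘ₗ (TensorProduct.assoc ℂ C C N).toLinearMap =
        (TensorProduct.assoc ℂ C C M).toLinearMap ∘ₗ i.lTensor (C ⊗[ℂ] C) := by
      ext; simp
    have e2 : i.lTensor (C ⊗[ℂ] C) ∘ₗ (Coalgebra.comul (R := ℂ) (A := C)).rTensor N =
        (Coalgebra.comul (R := ℂ) (A := C)).rTensor M ∘ₗ i.lTensor C := by
      ext; simp
    have h' := h.coassoc
    have e3 : (i.lTensor C).lTensor C ∘ₗ σ.lTensor C = ρ.lTensor C ∘ₗ i.lTensor C := by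
      rw [← LinearMap.lTensor_comp, hσ, LinearMap.lTensor_comp]
    simp only [LinearMap.ext_iff, LinearMap.comp_apply, LinearEquiv.coe_coe] at e1 e2 e3 hσ h'
    ext m
    simp only [LinearMap.comp_apply, LinearEquiv.coe_coe]
    rw [e1, e2, hσ, h', e3, hσ]
  · rw [← LinearMap.cancel_left (f := i.lTensor ℂ)
      (Module.Flat.lTensor_preserves_injective_linearMap _ hi)]
    have e1 : i.lTensor ℂ ∘ₗ (Coalgebra.counit (R := ℂ) (A := C)).rTensor N =
        (Coalgebra.counit (R := ℂ) (A := C)).rTensor M ∘ₗ i.lTensor C := by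
      ext; simp
    rw [← LinearMap.comp_assoc, e1, LinearMap.comp_assoc, hσ, ← LinearMap.comp_assoc, h.counit]
    ext; simp

theorem IsRightCoaction.ofInjective [Module.Flat ℂ D] {ρ : M →ₗ[ℂ] M ⊗[ℂ] D} (h : IsRightCoaction ρ)
    (i : N →ₗ[ℂ] M) (hi : Function.Injective i)
    (σ : N →ₗ[ℂ] N ⊗[ℂ] D) (hσ : i.rTensor D ∘ₗ σ = ρ ∘ₗ i) :
    IsRightCoaction σ := by
  constructor
  · rw [← LinearMap.cancel_left (f := i.rTensor (D ⊗[ℂ] D))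
      (Module.Flat.rTensor_preserves_injective_linearMap _ hi)]
    have e1 : i.rTensor (D ⊗[ℂ] D) ∘ₗ (TensorProduct.assoc ℂ N D D).toLinearMap =
        (TensorProduct.assoc ℂ M D D).toLinearMap ∘ₗ (i.rTensor D).rTensor D := by
      ext; simp
    have e2 : (i.rTensor D).rTensor D ∘ₗ σ.rTensor D = ρ.rTensor D ∘ₗ i.rTensor D := by
      rw [← LinearMap.rTensor_comp, hσ, LinearMap.rTensor_comp]
    have e3 : i.rTensor (D ⊗[ℂ] D) ∘ₗ (Coalgebra.comul (R := ℂ) (A := D)).lTensor N =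
        (Coalgebra.comul (R := ℂ) (A := D)).lTensor M ∘ₗ i.rTensor D := by
      ext; simp
    have h' := h.coassoc
    simp only [LinearMap.ext_iff, LinearMap.comp_apply, LinearEquiv.coe_coe] at e1 e2 e3 hσ h'
    ext m
    simp only [LinearMap.comp_apply, LinearEquiv.coe_coe]
    rw [e1, e2, hσ, h', e3, hσ]
  · rw [← LinearMap.cancel_left (f := i.rTensor ℂ)
      (Module.Flat.rTensor_preserves_injective_linearMap _ hi)]
    have e1 : i.rTensor ℂ ∘ₗ (Coalgebra.counit (R := ℂ) (A := D)).lTensor N =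
        (Coalgebra.counit (R := ℂ) (A := D)).lTensor M ∘ₗ i.rTensor D := by
      ext; simp
    rw [← LinearMap.comp_assoc, e1, LinearMap.comp_assoc, hσ, ← LinearMap.comp_assoc, h.counit]
    ext; simp

theorem CoactionsCommute.ofInjective [Module.Flat ℂ C] [Module.Flat ℂ D]
    {l : M →ₗ[ℂ] C ⊗[ℂ] M} {r : M →ₗ[ℂ] M ⊗[ℂ] D}
    (h : CoactionsCommute l r) (i : N →ₗ[ℂ] M) (hi : Function.Injective i)
    (l' : N →ₗ[ℂ] C ⊗[ℂ] N) (hl : i.lTensor C ∘ₗ l' = l ∘ₗ i)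
    (r' : N →ₗ[ℂ] N ⊗[ℂ] D) (hr : i.rTensor D ∘ₗ r' = r ∘ₗ i) :
    CoactionsCommute l' r' := by
  unfold CoactionsCommute at *
  rw [← LinearMap.cancel_left (f := (i.rTensor D).lTensor C)
      (Module.Flat.lTensor_preserves_injective_linearMap _
        (Module.Flat.rTensor_preserves_injective_linearMap _ hi))]
  have e1 : (i.rTensor D).lTensor C ∘ₗ (TensorProduct.assoc ℂ C N D).toLinearMap =
      (TensorProduct.assoc ℂ C M D).toLinearMap ∘ₗ (i.lTensor C).rTensor D := by
    ext; simp
  have e2 : (i.lTensor C).rTensor D ∘ₗ l'.rTensor D = l.rTensor D ∘ₗ i.rTensor D := by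
    rw [← LinearMap.rTensor_comp, hl, LinearMap.rTensor_comp]
  have e3 : (i.rTensor D).lTensor C ∘ₗ r'.lTensor C = r.lTensor C ∘ₗ i.lTensor C := by
    rw [← LinearMap.lTensor_comp, hr, LinearMap.lTensor_comp]
  simp only [LinearMap.ext_iff, LinearMap.comp_apply, LinearEquiv.coe_coe] at e1 e2 e3 hl hr h
  ext m
  simp only [LinearMap.comp_apply, LinearEquiv.coe_coe]
  rw [e1, e2, hr, h, e3, hl]

variable (C D M)

/-- The left coaction `c ⊗ m ↦ c₁ ⊗ (c₂ ⊗ m)` on `C ⊗ M`. -/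
def freeLeft : C ⊗[ℂ] M →ₗ[ℂ] C ⊗[ℂ] (C ⊗[ℂ] M) :=
  (TensorProduct.assoc ℂ C C M).toLinearMap ∘ₗ (Coalgebra.comul (R := ℂ) (A := C)).rTensor M

variable {D M}

/-- The right coaction `c ⊗ m ↦ (c ⊗ m₀) ⊗ m₁` on `C ⊗ M`, for `M` a right comodule. -/
def freeRight (r : M →ₗ[ℂ] M ⊗[ℂ] D) : C ⊗[ℂ] M →ₗ[ℂ] (C ⊗[ℂ] M) ⊗[ℂ] D :=
  (TensorProduct.assoc ℂ C M D).symm.toLinearMap ∘ₗ r.lTensor C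

variable {C}
variable (C M)

theorem isLeftCoaction_freeLeft : IsLeftCoaction (freeLeft C M) := by
  constructor
  · have e1 : (TensorProduct.assoc ℂ C C (C ⊗[ℂ] M)).toLinearMap ∘ₗ
        (Coalgebra.comul (R := ℂ) (A := C)).rTensor (C ⊗[ℂ] M) ∘ₗ
        (TensorProduct.assoc ℂ C C M).toLinearMap =
        (TensorProduct.assoc ℂ C C M).toLinearMap.lTensor C ∘ₗ
        (TensorProduct.assoc ℂ C (C ⊗[ℂ] C) M).toLinearMap ∘ₗ
        ((TensorProduct.assoc ℂ C C C).toLinearMap ∘ₗ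
          (Coalgebra.comul (R := ℂ) (A := C)).rTensor C).rTensor M := by
      ext c d m
      simp only [TensorProduct.AlgebraTensorModule.curry_apply, LinearMap.restrictScalars_self,
        TensorProduct.curry_apply, LinearMap.comp_apply, LinearEquiv.coe_coe,
        TensorProduct.assoc_tmul, LinearMap.rTensor_tmul]
      induction Coalgebra.comul (R := ℂ) c using TensorProduct.induction_on with
      | zero => simp
      | tmul x y => simp
      | add x y hx hy => simp only [TensorProduct.add_tmul, map_add, hx, hy]
    have e2 : (freeLeft C M).lTensor C ∘ₗ (TensorProduct.assoc ℂ C C M).toLinearMap =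
        (TensorProduct.assoc ℂ C C M).toLinearMap.lTensor C ∘ₗ
        (TensorProduct.assoc ℂ C (C ⊗[ℂ] C) M).toLinearMap ∘ₗ
        ((Coalgebra.comul (R := ℂ) (A := C)).lTensor C).rTensor M := by
      ext c d m
      simp [freeLeft]
    have e := congrArg (LinearMap.rTensor M) (Coalgebra.coassoc (R := ℂ) (A := C))
    ext c m
    have e' := LinearMap.congr_fun e (c ⊗ₜ m)
    have e1' := LinearMap.congr_fun e1 (Coalgebra.comul (R := ℂ) c ⊗ₜ m)
    have e2' := LinearMap.congr_fun e2 (Coalgebra.comul (R := ℂ) c ⊗ₜ m)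
    simp only [LinearMap.comp_apply, LinearMap.rTensor_tmul, LinearEquiv.coe_coe] at e' e1' e2'
    simp only [TensorProduct.AlgebraTensorModule.curry_apply, LinearMap.restrictScalars_self,
      TensorProduct.curry_apply, LinearMap.comp_apply, LinearEquiv.coe_coe]
    rw [freeLeft] at *
    simp only [LinearMap.comp_apply, LinearMap.rTensor_tmul, LinearEquiv.coe_coe]
    rw [e1', e', e2']
  · ext c m
    have e := LinearMap.congr_fun (Coalgebra.rTensor_counit_comp_comul (R := ℂ) (A := C)) c
    have e1 : (Coalgebra.counit (R := ℂ) (A := C)).rTensor (C ⊗[ℂ] M) ∘ₗ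
      (TensorProduct.assoc ℂ C C M).toLinearMap = (TensorProduct.assoc ℂ ℂ C M).toLinearMap ∘ₗ
      ((Coalgebra.counit (R := ℂ) (A := C)).rTensor C).rTensor M := by
      ext; simp
    have e1' := LinearMap.congr_fun e1 (Coalgebra.comul (R := ℂ) c ⊗ₜ m)
    simp only [LinearMap.comp_apply, LinearMap.rTensor_tmul, LinearEquiv.coe_coe] at e1' e
    simp only [TensorProduct.AlgebraTensorModule.curry_apply, LinearMap.restrictScalars_self,
      TensorProduct.curry_apply, LinearMap.comp_apply, LinearEquiv.coe_coe, freeLeft,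
      LinearMap.rTensor_tmul]
    rw [e1', e]
    simp

variable {M}

theorem isRightCoaction_freeRight {r : M →ₗ[ℂ] M ⊗[ℂ] D} (h : IsRightCoaction r) :
    IsRightCoaction (freeRight C r) := by
  constructor
  · have e1 : (TensorProduct.assoc ℂ (C ⊗[ℂ] M) D D).toLinearMap ∘ₗ
        (freeRight C r).rTensor D ∘ₗ (TensorProduct.assoc ℂ C M D).symm.toLinearMap =
        (TensorProduct.assoc ℂ C M (D ⊗[ℂ] D)).symm.toLinearMap ∘ₗ
        ((TensorProduct.assoc ℂ M D D).toLinearMap ∘ₗ r.rTensor D).lTensor C := by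
      ext c m d
      simp only [TensorProduct.AlgebraTensorModule.curry_apply, LinearMap.restrictScalars_self,
        TensorProduct.curry_apply, LinearMap.comp_apply, LinearEquiv.coe_coe, freeRight,
        TensorProduct.assoc_symm_tmul, LinearMap.rTensor_tmul, LinearMap.lTensor_tmul,
        LinearMap.comp_apply]
      induction r m using TensorProduct.induction_on with
      | zero => simp
      | tmul x y => simp
      | add x y hx hy => simp only [TensorProduct.tmul_add, TensorProduct.add_tmul, map_add, hx, hy]
    have e2 : (Coalgebra.comul (R := ℂ) (A := D)).lTensor (C ⊗[ℂ] M) ∘ₗ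
        (TensorProduct.assoc ℂ C M D).symm.toLinearMap =
        (TensorProduct.assoc ℂ C M (D ⊗[ℂ] D)).symm.toLinearMap ∘ₗ
        ((Coalgebra.comul (R := ℂ) (A := D)).lTensor M).lTensor C := by
      ext; simp
    have h' := congrArg (LinearMap.lTensor C) h.coassoc
    simp only [LinearMap.lTensor_comp, LinearMap.ext_iff, LinearMap.comp_apply,
      LinearEquiv.coe_coe] at e1 e2 h'
    refine LinearMap.ext fun x => ?_
    have e1' := e1 (r.lTensor C x)
    simp only [LinearMap.comp_apply, LinearEquiv.coe_coe]
    rw [show freeRight C r x = (TensorProduct.assoc ℂ C M D).symm (r.lTensor C x) from rfl,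
      e1', h', e2]
  · have e2 : (Coalgebra.counit (R := ℂ) (A := D)).lTensor (C ⊗[ℂ] M) ∘ₗ
        (TensorProduct.assoc ℂ C M D).symm.toLinearMap =
        (TensorProduct.assoc ℂ C M ℂ).symm.toLinearMap ∘ₗ
        ((Coalgebra.counit (R := ℂ) (A := D)).lTensor M).lTensor C := by
      ext; simp
    rw [freeRight, ← LinearMap.comp_assoc, e2, LinearMap.comp_assoc, ← LinearMap.lTensor_comp,
      h.counit]
    ext; simp

theorem coactionsCommute_free (r : M →ₗ[ℂ] M ⊗[ℂ] D) :
    CoactionsCommute (freeLeft C M) (freeRight C r) := by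
  have e0 : ∀ (y : C ⊗[ℂ] C) (m : M) (d : D),
      TensorProduct.assoc ℂ C (C ⊗[ℂ] M) D (TensorProduct.assoc ℂ C C M (y ⊗ₜ m) ⊗ₜ d) =
      (TensorProduct.assoc ℂ C M D).symm.toLinearMap.lTensor C
        (TensorProduct.assoc ℂ C C (M ⊗[ℂ] D) (y ⊗ₜ (m ⊗ₜ d))) := by
    intro y m d
    induction y using TensorProduct.induction_on with
    | zero => simp
    | tmul x y => simp
    | add x y hx hy => simp only [TensorProduct.add_tmul, map_add, hx, hy]
  have e1 : ∀ (c : C) (z : M ⊗[ℂ] D),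
      TensorProduct.assoc ℂ C (C ⊗[ℂ] M) D ((freeLeft C M).rTensor D
        ((TensorProduct.assoc ℂ C M D).symm (c ⊗ₜ z))) =
      (TensorProduct.assoc ℂ C M D).symm.toLinearMap.lTensor C
        (TensorProduct.assoc ℂ C C (M ⊗[ℂ] D) (Coalgebra.comul (R := ℂ) c ⊗ₜ z)) := by
    intro c z
    induction z using TensorProduct.induction_on with
    | zero => simp
    | tmul x y => simp [freeLeft, e0]
    | add x y hx hy => simp only [TensorProduct.tmul_add, map_add, hx, hy]
  have e2 : ∀ (y : C ⊗[ℂ] C) (m : M),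
      (freeRight C r).lTensor C (TensorProduct.assoc ℂ C C M (y ⊗ₜ m)) =
      (TensorProduct.assoc ℂ C M D).symm.toLinearMap.lTensor C
        (TensorProduct.assoc ℂ C C (M ⊗[ℂ] D) (y ⊗ₜ r m)) := by
    intro y m
    induction y using TensorProduct.induction_on with
    | zero => simp
    | tmul x y => simp [freeRight]
    | add x y hx hy => simp only [TensorProduct.add_tmul, map_add, hx, hy]
  unfold CoactionsCommute
  ext c m
  have e1' := e1 c (r m)
  have e2' := e2 (Coalgebra.comul (R := ℂ) c) m
  exact e1'.trans e2'.symm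

theorem freeLeft_lTensor (γ : M →ₗ[ℂ] N) :
    (γ.lTensor C).lTensor C ∘ₗ freeLeft C M = freeLeft C N ∘ₗ γ.lTensor C := by
  refine TensorProduct.ext' fun a v => ?_
  simp only [freeLeft, LinearMap.comp_apply, LinearMap.lTensor_tmul, LinearMap.rTensor_tmul,
    LinearEquiv.coe_coe]
  induction Coalgebra.comul (R := ℂ) a using TensorProduct.induction_on with
  | zero => simp
  | tmul x y => simp
  | add x y hx hy => simp only [TensorProduct.add_tmul, map_add, hx, hy]

theorem freeRight_lTensor (γ : M →ₗ[ℂ] N) (r : M →ₗ[ℂ] M ⊗[ℂ] D) (r' : N →ₗ[ℂ] N ⊗[ℂ] D)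
    (h : r' ∘ₗ γ = γ.rTensor D ∘ₗ r) :
    (γ.lTensor C).rTensor D ∘ₗ freeRight C r = freeRight C r' ∘ₗ γ.lTensor C := by
  refine TensorProduct.ext' fun a v => ?_
  have e := LinearMap.congr_fun h v
  simp only [LinearMap.comp_apply] at e
  simp only [freeRight, LinearMap.comp_apply, LinearMap.lTensor_tmul, LinearEquiv.coe_coe, e]
  induction r v using TensorProduct.induction_on with
  | zero => simp
  | tmul x y => simp
  | add x y hx hy => simp only [TensorProduct.tmul_add, map_add, hx, hy]

end Coactions

section Flatness

variable {C M N : Type*} [AddCommGroup C] [Module ℂ C]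
  [AddCommGroup M] [Module ℂ M] [AddCommGroup N] [Module ℂ N] (f g : M →ₗ[ℂ] N)

theorem exact_eqLocus : Function.Exact (LinearMap.eqLocus f g).subtype (f - g) := by
  intro x
  simp [sub_eq_zero]

theorem mem_range_lTensor (x : C ⊗[ℂ] M) (h : f.lTensor C x = g.lTensor C x) :
    x ∈ LinearMap.range ((LinearMap.eqLocus f g).subtype.lTensor C) := by
  refine (Module.Flat.lTensor_exact C (exact_eqLocus f g) x).1 ?_
  rw [LinearMap.lTensor_sub, LinearMap.sub_apply, h, sub_self]

theorem mem_range_rTensor (x : M ⊗[ℂ] C) (h : f.rTensor C x = g.rTensor C x) :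
    x ∈ LinearMap.range ((LinearMap.eqLocus f g).subtype.rTensor C) := by
  refine (Module.Flat.rTensor_exact C (exact_eqLocus f g) x).1 ?_
  rw [LinearMap.rTensor_sub, LinearMap.sub_apply, h, sub_self]

end Flatness

section Cotensor

variable {C X V : Type*} [AddCommMonoid C] [Module ℂ C] [AddCommMonoid X] [Module ℂ X]
  [AddCommMonoid V] [Module ℂ V]

/-- The cotensor product of the right comodule `(X, ρ)` and the left comodule `(V, l)`: the
equaliser of `ρ ⊗ id` and `id ⊗ l`. -/
def cotensor (ρ : X →ₗ[ℂ] X ⊗[ℂ] C) (l : V →ₗ[ℂ] C ⊗[ℂ] V) : Submodule ℂ (X ⊗[ℂ] V) :=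
  LinearMap.eqLocus ((TensorProduct.assoc ℂ X C V).toLinearMap ∘ₗ ρ.rTensor V) (l.lTensor X)

theorem mem_cotensor_iff (ρ : X →ₗ[ℂ] X ⊗[ℂ] C) (l : V →ₗ[ℂ] C ⊗[ℂ] V) (x : X ⊗[ℂ] V) :
    x ∈ cotensor ρ l ↔ TensorProduct.assoc ℂ X C V (ρ.rTensor V x) = l.lTensor X x :=
  Iff.rfl

end Cotensor

/-! ### Quantum homogeneous spaces -/

section Balanced

variable {A : Type u} [Ring A] [Algebra ℂ A] (B : Subalgebra ℂ A)
variable (M N : Type*) [AddCommGroup M] [Module ℂ M] [Module B M] [IsScalarTower ℂ B M]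
  [AddCommGroup N] [Module ℂ N] [Module B N] [IsScalarTower ℂ B N]

/-- The subspace of `A ⊗ M` spanned by the elements `ab ⊗ m - a ⊗ bm`, where `b ∈ B`. -/
def balancingRelations : Submodule ℂ (A ⊗[ℂ] M) :=
  Submodule.span ℂ {t | ∃ (a : A) (b : B) (m : M), t = (a * (b : A)) ⊗ₜ[ℂ] m - a ⊗ₜ[ℂ] (b • m)}

/-- The vector space `A ⊗_B M`, for the right `B`-module `A` and a left `B`-module `M`. -/
abbrev BalancedTensor : Type _ := (A ⊗[ℂ] M) ⧸ balancingRelations B M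

variable {M N}

/-- The linear map `id ⊗_B f : A ⊗_B M → A ⊗_B N`. -/
def BalancedTensor.map (f : M →ₗ[B] N) : BalancedTensor B M →ₗ[ℂ] BalancedTensor B N :=
  Submodule.mapQ _ _ ((f.restrictScalars ℂ).lTensor A) <| by
    rw [balancingRelations, Submodule.span_le]
    rintro _ ⟨a, b, m, rfl⟩
    refine Submodule.subset_span ⟨a, b, f m, ?_⟩
    simp

/-- `A` is faithfully flat as a right `B`-module: the functor `A ⊗_B -` from left `B`-modules to
vector spaces preserves and reflects exact sequences. -/
def IsFaithfullyFlatRight : Prop :=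
  ∀ (M N Q : Type u) [AddCommGroup M] [Module ℂ M] [Module B M] [IsScalarTower ℂ B M]
    [AddCommGroup N] [Module ℂ N] [Module B N] [IsScalarTower ℂ B N]
    [AddCommGroup Q] [Module ℂ Q] [Module B Q] [IsScalarTower ℂ B Q]
    (f : M →ₗ[B] N) (g : N →ₗ[B] Q),
    Function.Exact f g ↔ Function.Exact (BalancedTensor.map B f) (BalancedTensor.map B g)

end Balanced

section QHS

variable {A : Type u} [Ring A] [HopfAlgebra ℂ A]

/-- `B⁺ = B ∩ ker ε`. -/
def plusPart (B : Subalgebra ℂ A) : Submodule ℂ A :=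
  Subalgebra.toSubmodule B ⊓ LinearMap.ker (Coalgebra.counit (R := ℂ) (A := A))

variable (A) in
/-- A quantum homogeneous `A`-space: a left coideal subalgebra `B` of `A` (that is,
`Δ(B) ⊆ A ⊗ B`) such that `A` is faithfully flat as a right `B`-module and `B⁺A = AB⁺`. -/
structure QuantumHomogeneousSpace extends Subalgebra ℂ A where
  comul_mem : ∀ b ∈ toSubalgebra, Coalgebra.comul (R := ℂ) b ∈
    LinearMap.range ((Subalgebra.toSubmodule toSubalgebra).subtype.lTensor A)
  faithfullyFlat : IsFaithfullyFlatRight toSubalgebra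
  plus_mul_top : plusPart toSubalgebra * ⊤ = ⊤ * plusPart toSubalgebra

namespace QuantumHomogeneousSpace

variable (B : QuantumHomogeneousSpace A)

/-- The inclusion of `B` in `A`, as a linear map. -/
def incl : B.toSubalgebra →ₗ[ℂ] A := B.toSubalgebra.val.toLinearMap

@[simp] theorem incl_apply (b : B.toSubalgebra) : B.incl b = b := rfl

theorem incl_injective : Function.Injective B.incl := Subtype.val_injective

/-- The left `A`-coaction on `B`, that is, the coproduct of `A` restricted to a map
`B → A ⊗ B`. -/
def coact : B.toSubalgebra →ₗ[ℂ] A ⊗[ℂ] B.toSubalgebra :=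
  LinearMap.codRestrictOfInjective (Coalgebra.comul (R := ℂ) (A := A) ∘ₗ B.incl)
    (B.incl.lTensor A)
    (Module.Flat.lTensor_preserves_injective_linearMap _ B.incl_injective)
    (fun b => B.comul_mem b b.2)

theorem incl_coact (b : B.toSubalgebra) :
    B.incl.lTensor A (B.coact b) = Coalgebra.comul (R := ℂ) (b : A) :=
  LinearMap.codRestrictOfInjective_comp_apply _ _ _ _ b

section TensorAction

variable (F : Type*) [AddCommGroup F] [Module ℂ F] [Module B.toSubalgebra F]
  [IsScalarTower ℂ B.toSubalgebra F]

/-- The action of `A ⊗ B` on `A ⊗ F`: `(a ⊗ b)(a' ⊗ f) = aa' ⊗ bf`. -/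
def tensorAct : A ⊗[ℂ] B.toSubalgebra →ₗ[ℂ] A ⊗[ℂ] F →ₗ[ℂ] A ⊗[ℂ] F :=
  TensorProduct.map₂ (LinearMap.mul ℂ A)
    (Algebra.lsmul ℂ ℂ F : B.toSubalgebra →ₐ[ℂ] Module.End ℂ F).toLinearMap

variable {F}

@[simp] theorem tensorAct_tmul (a a' : A) (b : B.toSubalgebra) (f : F) :
    B.tensorAct F (a ⊗ₜ b) (a' ⊗ₜ f) = (a * a') ⊗ₜ (b • f) := by
  simp [tensorAct]

theorem map_tensorAct_coact {A' N : Type*} [AddCommGroup A'] [Module ℂ A']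
    [AddCommGroup N] [Module ℂ N] (p : A →ₗ[ℂ] A') (q : F →ₗ[ℂ] N)
    (hq : ∀ (b : B.toSubalgebra) (f : F),
      q (b • f) = Coalgebra.counit (R := ℂ) (b : A) • q f)
    (b : B.toSubalgebra) (y : A ⊗[ℂ] F) :
    TensorProduct.map p q (B.tensorAct F (B.coact b) y) = TensorProduct.map p q (b • y) := by
  have key : ∀ (x : A ⊗[ℂ] B.toSubalgebra) (a : A) (f : F),
      TensorProduct.map p q (B.tensorAct F x (a ⊗ₜ f)) =
      p (TensorProduct.rid ℂ A ((Coalgebra.counit (R := ℂ) (A := A)).lTensor A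
        (B.incl.lTensor A x)) * a) ⊗ₜ q f := by
    intro x a f
    induction x using TensorProduct.induction_on with
    | zero => simp
    | tmul a' b => simp [hq, TensorProduct.smul_tmul']
    | add x y hx hy => simp only [map_add, LinearMap.add_apply, hx, hy, add_mul,
        TensorProduct.add_tmul]
  induction y using TensorProduct.induction_on with
  | zero => simp
  | tmul a f =>
    rw [key, incl_coact, Coalgebra.lTensor_counit_comul, Subalgebra.smul_def, TensorProduct.smul_tmul']
    simp
  | add x y hx hy => rw [map_add, map_add, smul_add, map_add, hx, hy]

end TensorAction

theorem comul_mul_eq (b : B.toSubalgebra) (a : A) : Coalgebra.comul (R := ℂ) ((b : A) * a) =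
    B.tensorAct A (B.coact b) (Coalgebra.comul (R := ℂ) a) := by
  have e1 : ∀ (x : A ⊗[ℂ] B.toSubalgebra) (y : A ⊗[ℂ] A),
      B.incl.lTensor A x * y = B.tensorAct A x y := by
    intro x y
    induction x using TensorProduct.induction_on with
    | zero => simp
    | tmul a' b' =>
      induction y using TensorProduct.induction_on with
      | zero => simp
      | tmul a f => simp [Subalgebra.smul_def]
      | add x y hx hy => rw [mul_add, map_add, hx, hy]
    | add x y hx hy => rw [map_add, add_mul, map_add, LinearMap.add_apply, hx, hy]
  rw [Bialgebra.comul_mul, ← B.incl_coact b, e1]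

/-- The subspace `B⁺A = AB⁺` of `A`. -/
def plusIdeal : Submodule ℂ A := plusPart B.toSubalgebra * ⊤

/-- The quotient `π_B(A) = A / B⁺A`. -/
def Quot : Type u := A ⧸ B.plusIdeal

instance : AddCommGroup B.Quot := inferInstanceAs (AddCommGroup (A ⧸ B.plusIdeal))

instance : Module ℂ B.Quot := inferInstanceAs (Module ℂ (A ⧸ B.plusIdeal))

/-- The canonical surjection `π_B : A → π_B(A)`. -/
def proj : A →ₗ[ℂ] B.Quot := B.plusIdeal.mkQ

theorem proj_eq_zero_iff (a : A) : B.proj a = 0 ↔ a ∈ B.plusIdeal :=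
  Submodule.Quotient.mk_eq_zero _

theorem sub_counit_mem (b : B.toSubalgebra) :
    (b : A) - algebraMap ℂ A (Coalgebra.counit (R := ℂ) (b : A)) ∈ plusPart B.toSubalgebra := by
  refine ⟨B.toSubalgebra.sub_mem b.2 (B.toSubalgebra.algebraMap_mem _), ?_⟩
  simp

theorem proj_mul (b : B.toSubalgebra) (a : A) :
    B.proj ((b : A) * a) = Coalgebra.counit (R := ℂ) (b : A) • B.proj a := by
  rw [← map_smul, ← sub_eq_zero, ← map_sub, proj_eq_zero_iff,
    Algebra.smul_def, ← sub_mul]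
  exact Submodule.mul_mem_mul (B.sub_counit_mem b) Submodule.mem_top

instance isCoideal_plusIdeal : B.plusIdeal.IsCoideal where
  counit_eq_zero x hx := by
    refine Submodule.mul_induction_on hx (fun b hb a _ => ?_) (fun x y hx hy => ?_)
    · have : Coalgebra.counit (R := ℂ) b = 0 := hb.2
      simp [this]
    · simp [hx, hy]
  map_mkQ_comul_eq_zero x hx := by
    change TensorProduct.map B.proj B.proj (Coalgebra.comul (R := ℂ) x) = 0
    refine Submodule.mul_induction_on hx (fun b hb a _ => ?_) (fun x y hx hy => ?_)
    · have hbB : b ∈ B.toSubalgebra := hb.1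
      have e2 : ∀ y : A ⊗[ℂ] A,
          TensorProduct.map B.proj B.proj ((⟨b, hbB⟩ : B.toSubalgebra) • y) = 0 := by
        intro y
        induction y using TensorProduct.induction_on with
        | zero => simp
        | tmul a f =>
          have h0 : Coalgebra.counit (R := ℂ) b = 0 := hb.2
          have h1 := B.proj_mul ⟨b, hbB⟩ a
          simp only [h0, zero_smul] at h1
          rw [Subalgebra.smul_def, TensorProduct.smul_tmul', TensorProduct.map_tmul, smul_eq_mul,
            h1, TensorProduct.zero_tmul]
        | add x y hx hy => rw [smul_add, map_add, hx, hy, add_zero]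
      rw [B.comul_mul_eq ⟨b, hbB⟩ a,
        B.map_tensorAct_coact _ _ (fun b f => B.proj_mul b f), e2]
    · rw [map_add, map_add, hx, hy, add_zero]

/-- The coalgebra structure of `π_B(A)`, induced from that of `A`. -/
instance : Coalgebra ℂ B.Quot := inferInstanceAs (Coalgebra ℂ (A ⧸ B.plusIdeal))

/-- `π_B` is a map of coalgebras. -/
def projCoalgHom : A →ₗc[ℂ] B.Quot := Coalgebra.Quotient.mkQCoalgHom (R := ℂ) B.plusIdeal

/-- The right `π_B(A)`-coaction `(id ⊗ π_B) ∘ Δ` on `A`. -/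
def rightCoact : A →ₗ[ℂ] A ⊗[ℂ] B.Quot :=
  B.proj.lTensor A ∘ₗ Coalgebra.comul (R := ℂ) (A := A)

end QuantumHomogeneousSpace

/-! ### The categories -/

/-- A left comodule over the coalgebra `C`. -/
structure LeftComod (C : Type u) [AddCommGroup C] [Module ℂ C] [Coalgebra ℂ C] where
  carrier : Type u
  [addCommGroup : AddCommGroup carrier]
  [module : Module ℂ carrier]
  coact : carrier →ₗ[ℂ] C ⊗[ℂ] carrier
  isLeftCoaction : IsLeftCoaction coact

/-- A `(C, D)`-bicomodule. -/
structure Bicomod (C D : Type u) [AddCommGroup C] [Module ℂ C] [Coalgebra ℂ C]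
    [AddCommGroup D] [Module ℂ D] [Coalgebra ℂ D] extends LeftComod C where
  coactR : carrier →ₗ[ℂ] carrier ⊗[ℂ] D
  isRightCoaction : IsRightCoaction coactR
  commute : CoactionsCommute coact coactR

/-- A relative Hopf module: a left `A`-comodule with a left `B`-action such that
`Δ_L(bf) = Δ(b) Δ_L(f)`. -/
structure RelHopfMod (B : QuantumHomogeneousSpace A) where
  carrier : Type u
  [addCommGroup : AddCommGroup carrier]
  [module : Module ℂ carrier]
  [moduleB : Module B.toSubalgebra carrier]
  [isScalarTower : IsScalarTower ℂ B.toSubalgebra carrier]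
  coact : carrier →ₗ[ℂ] A ⊗[ℂ] carrier
  isLeftCoaction : IsLeftCoaction coact
  coact_smul : ∀ (b : B.toSubalgebra) (f : carrier),
    coact (b • f) = B.tensorAct carrier (B.coact b) (coact f)

attribute [instance] LeftComod.addCommGroup LeftComod.module
  RelHopfMod.addCommGroup RelHopfMod.module RelHopfMod.moduleB RelHopfMod.isScalarTower

/-- An `(A, D)`-bicomodule with a left `B`-action that makes it a relative Hopf module and for
which the right coaction is `B`-linear, with `B` acting on the first factor of `F ⊗ D`. -/
structure RelHopfBimod (B : QuantumHomogeneousSpace A)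
    (D : Type u) [AddCommGroup D] [Module ℂ D] [Coalgebra ℂ D] extends RelHopfMod B where
  coactR : carrier →ₗ[ℂ] carrier ⊗[ℂ] D
  isRightCoaction : IsRightCoaction coactR
  commute : CoactionsCommute coact coactR
  coactR_smul : ∀ (b : B.toSubalgebra) (f : carrier), coactR (b • f) = b • coactR f

section Homs

variable {B : QuantumHomogeneousSpace A}
variable {C D : Type u} [AddCommGroup C] [Module ℂ C] [Coalgebra ℂ C]
  [AddCommGroup D] [Module ℂ D] [Coalgebra ℂ D]

/-- Left comodule maps. -/
@[ext] structure LeftComod.Hom (V W : LeftComod C) where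
  map : V.carrier →ₗ[ℂ] W.carrier
  comm : W.coact ∘ₗ map = map.lTensor C ∘ₗ V.coact

instance : Category (LeftComod C) where
  Hom := LeftComod.Hom
  id V := ⟨LinearMap.id, by simp⟩
  comp f g := ⟨g.map ∘ₗ f.map, by
    rw [← LinearMap.comp_assoc, g.comm, LinearMap.comp_assoc, f.comm, ← LinearMap.comp_assoc,
      LinearMap.lTensor_comp]⟩

/-- Bicomodule maps. -/
@[ext] structure Bicomod.Hom (V W : Bicomod C D) where
  hom : V.toLeftComod ⟶ W.toLeftComod
  commR : W.coactR ∘ₗ hom.map = hom.map.rTensor D ∘ₗ V.coactR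

instance : Category (Bicomod C D) where
  Hom := Bicomod.Hom
  id V := ⟨𝟙 V.toLeftComod, by
    change _ ∘ₗ LinearMap.id = LinearMap.id.rTensor D ∘ₗ _
    simp⟩
  comp f g := ⟨f.hom ≫ g.hom, by
    change _ ∘ₗ (g.hom.map ∘ₗ f.hom.map) = (g.hom.map ∘ₗ f.hom.map).rTensor D ∘ₗ _
    rw [← LinearMap.comp_assoc, g.commR, LinearMap.comp_assoc, f.commR, ← LinearMap.comp_assoc,
      LinearMap.rTensor_comp]⟩
  id_comp _ := Bicomod.Hom.ext (Category.id_comp _)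
  comp_id _ := Bicomod.Hom.ext (Category.comp_id _)
  assoc _ _ _ := Bicomod.Hom.ext (Category.assoc _ _ _)

/-- Left `A`-comodule, left `B`-module maps. -/
@[ext] structure RelHopfMod.Hom (F G : RelHopfMod B) where
  map : F.carrier →ₗ[B.toSubalgebra] G.carrier
  comm : G.coact ∘ₗ map.restrictScalars ℂ = (map.restrictScalars ℂ).lTensor A ∘ₗ F.coact

instance : Category (RelHopfMod B) where
  Hom := RelHopfMod.Hom
  id V := ⟨LinearMap.id, by
    change _ ∘ₗ LinearMap.id = LinearMap.id.lTensor A ∘ₗ _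
    simp⟩
  comp f g := ⟨g.map ∘ₗ f.map, by
    change _ ∘ₗ (g.map.restrictScalars ℂ ∘ₗ f.map.restrictScalars ℂ) =
      (g.map.restrictScalars ℂ ∘ₗ f.map.restrictScalars ℂ).lTensor A ∘ₗ _
    rw [← LinearMap.comp_assoc, g.comm, LinearMap.comp_assoc, f.comm, ← LinearMap.comp_assoc,
      LinearMap.lTensor_comp]⟩

/-- Morphisms of relative Hopf modules that are also right `D`-comodule maps. -/
@[ext] structure RelHopfBimod.Hom (F G : RelHopfBimod B D) where
  hom : F.toRelHopfMod ⟶ G.toRelHopfMod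
  commR : G.coactR ∘ₗ hom.map.restrictScalars ℂ =
    (hom.map.restrictScalars ℂ).rTensor D ∘ₗ F.coactR

instance : Category (RelHopfBimod B D) where
  Hom := RelHopfBimod.Hom
  id V := ⟨𝟙 V.toRelHopfMod, by
    change _ ∘ₗ LinearMap.id = LinearMap.id.rTensor D ∘ₗ _
    simp⟩
  comp f g := ⟨f.hom ≫ g.hom, by
    change _ ∘ₗ (g.hom.map.restrictScalars ℂ ∘ₗ f.hom.map.restrictScalars ℂ) =
      (g.hom.map.restrictScalars ℂ ∘ₗ f.hom.map.restrictScalars ℂ).rTensor D ∘ₗ _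
    rw [← LinearMap.comp_assoc, g.commR, LinearMap.comp_assoc, f.commR, ← LinearMap.comp_assoc,
      LinearMap.rTensor_comp]⟩
  id_comp _ := RelHopfBimod.Hom.ext (Category.id_comp _)
  comp_id _ := RelHopfBimod.Hom.ext (Category.comp_id _)
  assoc _ _ _ := RelHopfBimod.Hom.ext (Category.assoc _ _ _)

variable (C D) in
/-- The functor that forgets the right coaction. -/
def Bicomod.forgetRight : Bicomod C D ⥤ LeftComod C where
  obj V := V.toLeftComod
  map f := f.hom

variable (B D) in
/-- The functor that forgets the right coaction. -/
def RelHopfBimod.forgetRight : RelHopfBimod B D ⥤ RelHopfMod B where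
  obj F := F.toRelHopfMod
  map f := f.hom

end Homs

/-! ### The functor `Φ` -/

namespace QuantumHomogeneousSpace

variable (B : QuantumHomogeneousSpace A)
variable {D : Type u} [AddCommGroup D] [Module ℂ D] [Coalgebra ℂ D]

section PlusSMul

variable (F : Type*) [AddCommGroup F] [Module ℂ F] [Module B.toSubalgebra F]
  [IsScalarTower ℂ B.toSubalgebra F]

/-- The subspace `B⁺F` of a left `B`-module `F`. -/
def plusSMul : Submodule ℂ F :=
  Submodule.span ℂ {x | ∃ (b : B.toSubalgebra) (f : F),
    (b : A) ∈ plusPart B.toSubalgebra ∧ x = b • f}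

variable {F}

theorem mkQ_smul (b : B.toSubalgebra) (f : F) :
    (B.plusSMul F).mkQ (b • f) = Coalgebra.counit (R := ℂ) (b : A) • (B.plusSMul F).mkQ f := by
  rw [← map_smul, ← sub_eq_zero, ← map_sub, Submodule.mkQ_apply, Submodule.Quotient.mk_eq_zero,
    ← algebraMap_smul B.toSubalgebra, ← sub_smul]
  exact Submodule.subset_span ⟨_, f, B.sub_counit_mem b, rfl⟩

theorem counit_eq_zero_of_mem {b : A} (hb : b ∈ plusPart B.toSubalgebra) :
    Coalgebra.counit (R := ℂ) b = 0 := hb.2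

variable {G : Type*} [AddCommGroup G] [Module ℂ G] [Module B.toSubalgebra G]
  [IsScalarTower ℂ B.toSubalgebra G]

theorem plusSMul_le_comap (f : F →ₗ[B.toSubalgebra] G) :
    B.plusSMul F ≤ (B.plusSMul G).comap (f.restrictScalars ℂ) := by
  rw [plusSMul, Submodule.span_le]
  rintro _ ⟨b, x, hb, rfl⟩
  exact Submodule.subset_span ⟨b, f x, hb, by simp⟩

/-- The map `F / B⁺F → G / B⁺G` induced by a `B`-linear map. -/
def phiMap (f : F →ₗ[B.toSubalgebra] G) : F ⧸ B.plusSMul F →ₗ[ℂ] G ⧸ B.plusSMul G :=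
  Submodule.mapQ _ _ (f.restrictScalars ℂ) (B.plusSMul_le_comap f)

theorem phiMap_comp_mkQ (f : F →ₗ[B.toSubalgebra] G) :
    B.phiMap f ∘ₗ (B.plusSMul F).mkQ = (B.plusSMul G).mkQ ∘ₗ f.restrictScalars ℂ :=
  Submodule.mapQ_mkQ _ _ _

end PlusSMul

/-- The left `π_B(A)`-coaction `[f] ↦ π_B(f₍₋₁₎) ⊗ [f₍₀₎]` on `F / B⁺F`. -/
def phiCoact (F : RelHopfMod B) :
    F.carrier ⧸ B.plusSMul F.carrier →ₗ[ℂ] B.Quot ⊗[ℂ] (F.carrier ⧸ B.plusSMul F.carrier) :=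
  (B.plusSMul F.carrier).liftQ
    (TensorProduct.map B.proj (B.plusSMul F.carrier).mkQ ∘ₗ F.coact) <| by
    rw [plusSMul, Submodule.span_le]
    rintro _ ⟨b, f, hb, rfl⟩
    have h : ∀ y : A ⊗[ℂ] F.carrier,
        TensorProduct.map B.proj (B.plusSMul F.carrier).mkQ (b • y) = 0 := by
      intro y
      induction y using TensorProduct.induction_on with
      | zero => simp
      | tmul a f =>
        rw [Subalgebra.smul_def, TensorProduct.smul_tmul', TensorProduct.map_tmul, smul_eq_mul,
          B.proj_mul, B.counit_eq_zero_of_mem hb, zero_smul, TensorProduct.zero_tmul]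
      | add x y hx hy => rw [smul_add, map_add, hx, hy, add_zero]
    change TensorProduct.map B.proj (B.plusSMul F.carrier).mkQ (F.coact (b • f)) = 0
    rw [F.coact_smul, B.map_tensorAct_coact _ _ (fun b f => B.mkQ_smul b f), h]

theorem phiCoact_comp_mkQ (F : RelHopfMod B) :
    B.phiCoact F ∘ₗ (B.plusSMul F.carrier).mkQ =
      TensorProduct.map B.proj (B.plusSMul F.carrier).mkQ ∘ₗ F.coact :=
  Submodule.liftQ_mkQ _ _ _

/-- The functor `Φ(F) = F / B⁺F` from relative Hopf modules to left `π_B(A)`-comodules. -/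
def Phi : RelHopfMod B ⥤ LeftComod B.Quot where
  obj F :=
    { carrier := F.carrier ⧸ B.plusSMul F.carrier
      coact := B.phiCoact F
      isLeftCoaction := F.isLeftCoaction.ofSurjective
        B.projCoalgHom _
        (Submodule.mkQ_surjective _) _ (B.phiCoact_comp_mkQ F) }
  map {F G} f :=
    { map := B.phiMap f.map
      comm := by
        rw [← LinearMap.cancel_right (Submodule.mkQ_surjective (B.plusSMul F.carrier)),
          LinearMap.comp_assoc, LinearMap.comp_assoc, B.phiCoact_comp_mkQ F, phiMap_comp_mkQ,
          ← LinearMap.comp_assoc, B.phiCoact_comp_mkQ G, LinearMap.comp_assoc, f.comm, ← LinearMap.comp_assoc,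
          ← LinearMap.comp_assoc, LinearMap.lTensor_comp_map, phiMap_comp_mkQ,
          LinearMap.map_comp_lTensor] }
  map_id F := by
    apply LeftComod.Hom.ext
    exact Submodule.mapQ_id _
  map_comp f g := by
    apply LeftComod.Hom.ext
    apply Submodule.linearMap_qext
    rfl

/-- The right coaction `[f] ↦ [f₍₀₎] ⊗ f₍₁₎` on `F / B⁺F`. -/
def phiCoactR (F : RelHopfBimod B D) :
    F.carrier ⧸ B.plusSMul F.carrier →ₗ[ℂ] (F.carrier ⧸ B.plusSMul F.carrier) ⊗[ℂ] D :=
  (B.plusSMul F.carrier).liftQ ((B.plusSMul F.carrier).mkQ.rTensor D ∘ₗ F.coactR) <| by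
    rw [plusSMul, Submodule.span_le]
    rintro _ ⟨b, f, hb, rfl⟩
    have h : ∀ y : F.carrier ⊗[ℂ] D, (B.plusSMul F.carrier).mkQ.rTensor D (b • y) = 0 := by
      intro y
      induction y using TensorProduct.induction_on with
      | zero => simp
      | tmul a f =>
        rw [TensorProduct.smul_tmul', LinearMap.rTensor_tmul, B.mkQ_smul,
          B.counit_eq_zero_of_mem hb, zero_smul, TensorProduct.zero_tmul]
      | add x y hx hy => rw [smul_add, map_add, hx, hy, add_zero]
    change (B.plusSMul F.carrier).mkQ.rTensor D (F.coactR (b • f)) = 0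
    rw [F.coactR_smul, h]

theorem phiCoactR_comp_mkQ (F : RelHopfBimod B D) :
    B.phiCoactR F ∘ₗ (B.plusSMul F.carrier).mkQ =
      (B.plusSMul F.carrier).mkQ.rTensor D ∘ₗ F.coactR :=
  Submodule.liftQ_mkQ _ _ _

theorem phiMap_commR {F G : RelHopfBimod B D} (f : F ⟶ G) :
    B.phiCoactR G ∘ₗ B.phiMap f.hom.map = (B.phiMap f.hom.map).rTensor D ∘ₗ B.phiCoactR F := by
  rw [← LinearMap.cancel_right (Submodule.mkQ_surjective (B.plusSMul F.carrier)),
    LinearMap.comp_assoc, LinearMap.comp_assoc, B.phiCoactR_comp_mkQ F, phiMap_comp_mkQ,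
    ← LinearMap.comp_assoc, B.phiCoactR_comp_mkQ G, LinearMap.comp_assoc, f.commR,
    ← LinearMap.comp_assoc, ← LinearMap.comp_assoc, ← LinearMap.rTensor_comp,
    ← LinearMap.rTensor_comp, phiMap_comp_mkQ]

variable (D) in
/-- The functor `Φ` on relative Hopf modules with a compatible right `D`-coaction. -/
def PhiR : RelHopfBimod B D ⥤ Bicomod B.Quot D where
  obj F :=
    { toLeftComod := B.Phi.obj F.toRelHopfMod
      coactR := B.phiCoactR F
      isRightCoaction := F.isRightCoaction.ofSurjective _
        (Submodule.mkQ_surjective _) _ (B.phiCoactR_comp_mkQ F)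
      commute := F.commute.ofSurjective B.proj _ (Submodule.mkQ_surjective _) _
        (B.phiCoact_comp_mkQ F.toRelHopfMod) _ (B.phiCoactR_comp_mkQ F) }
  map f :=
    { hom := B.Phi.map f.hom
      commR := B.phiMap_commR f }
  map_id _ := Bicomod.Hom.ext (B.Phi.map_id _)
  map_comp _ _ := Bicomod.Hom.ext (B.Phi.map_comp _ _)

end QuantumHomogeneousSpace

/-! ### The functor `Ψ` -/

namespace QuantumHomogeneousSpace

variable (B : QuantumHomogeneousSpace A)
variable {D : Type u} [AddCommGroup D] [Module ℂ D] [Coalgebra ℂ D]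

section Actions

variable {V W : Type*} [AddCommGroup V] [Module ℂ V] [AddCommGroup W] [Module ℂ W]
variable {F G : Type*} [AddCommGroup F] [Module ℂ F] [Module B.toSubalgebra F]
  [IsScalarTower ℂ B.toSubalgebra F] [AddCommGroup G] [Module ℂ G] [Module B.toSubalgebra G]
  [IsScalarTower ℂ B.toSubalgebra G]

theorem smul_tmul_eq (b : B.toSubalgebra) (a : A) (v : V) :
    b • (a ⊗ₜ[ℂ] v) = ((b : A) * a) ⊗ₜ[ℂ] v := by
  rw [Subalgebra.smul_def, TensorProduct.smul_tmul', smul_eq_mul]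

theorem lTensor_smul (γ : V →ₗ[ℂ] W) (b : B.toSubalgebra) (x : A ⊗[ℂ] V) :
    γ.lTensor A (b • x) = b • γ.lTensor A x := by
  induction x using TensorProduct.induction_on with
  | zero => simp
  | tmul a v => simp only [smul_tmul_eq, LinearMap.lTensor_tmul]
  | add x y hx hy => simp only [smul_add, map_add, hx, hy]

theorem assoc_smul (b : B.toSubalgebra) (x : (A ⊗[ℂ] V) ⊗[ℂ] W) :
    TensorProduct.assoc ℂ A V W (b • x) = b • TensorProduct.assoc ℂ A V W x := by
  induction x using TensorProduct.induction_on with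
  | zero => simp
  | tmul y w =>
    induction y using TensorProduct.induction_on with
    | zero => simp
    | tmul a v =>
      rw [Subalgebra.smul_def, TensorProduct.smul_tmul', ← Subalgebra.smul_def, smul_tmul_eq]
      simp only [smul_tmul_eq, TensorProduct.assoc_tmul]
    | add x y hx hy => simp only [TensorProduct.add_tmul, smul_add, map_add, hx, hy]
  | add x y hx hy => simp only [smul_add, map_add, hx, hy]

theorem rightCoact_mul (b : B.toSubalgebra) (a : A) :
    B.rightCoact ((b : A) * a) = b • B.rightCoact a := by
  have h := B.map_tensorAct_coact (F := A) LinearMap.id B.proj (fun b f => B.proj_mul b f) b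
    (Coalgebra.comul (R := ℂ) a)
  rw [← B.comul_mul_eq] at h
  exact h.trans (B.lTensor_smul B.proj b _)

theorem rightCoact_rTensor_smul (b : B.toSubalgebra) (x : A ⊗[ℂ] V) :
    B.rightCoact.rTensor V (b • x) = b • B.rightCoact.rTensor V x := by
  induction x using TensorProduct.induction_on with
  | zero => simp
  | tmul a v =>
    simp only [smul_tmul_eq, LinearMap.rTensor_tmul, rightCoact_mul]
    rw [Subalgebra.smul_def, Subalgebra.smul_def, TensorProduct.smul_tmul']
  | add x y hx hy => simp only [smul_add, map_add, hx, hy]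

theorem lTensor_tensorAct (f : F →ₗ[B.toSubalgebra] G) (w : A ⊗[ℂ] B.toSubalgebra)
    (y : A ⊗[ℂ] F) :
    (f.restrictScalars ℂ).lTensor A (B.tensorAct F w y) =
      B.tensorAct G w ((f.restrictScalars ℂ).lTensor A y) := by
  induction w using TensorProduct.induction_on with
  | zero => simp
  | tmul a b =>
    induction y using TensorProduct.induction_on with
    | zero => simp
    | tmul a f => simp
    | add x y hx hy => simp only [map_add, hx, hy]
  | add x y hx hy => simp only [map_add, LinearMap.add_apply, hx, hy]

theorem assoc_tensorAct (w : A ⊗[ℂ] B.toSubalgebra) (y : A ⊗[ℂ] A) (v : V) :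
    TensorProduct.assoc ℂ A A V (B.tensorAct A w y ⊗ₜ v) =
      B.tensorAct (A ⊗[ℂ] V) w (TensorProduct.assoc ℂ A A V (y ⊗ₜ v)) := by
  induction w using TensorProduct.induction_on with
  | zero => simp
  | tmul a b =>
    induction y using TensorProduct.induction_on with
    | zero => simp
    | tmul a f => simp [smul_tmul_eq, Subalgebra.smul_def b f]
    | add x y hx hy => simp only [map_add, TensorProduct.add_tmul, hx, hy]
  | add x y hx hy => simp only [map_add, LinearMap.add_apply, TensorProduct.add_tmul, hx, hy]

theorem freeLeft_smul (b : B.toSubalgebra) (x : A ⊗[ℂ] V) :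
    freeLeft A V (b • x) = B.tensorAct (A ⊗[ℂ] V) (B.coact b) (freeLeft A V x) := by
  induction x using TensorProduct.induction_on with
  | zero => simp
  | tmul a v =>
    simp only [smul_tmul_eq, freeLeft, LinearMap.comp_apply, LinearMap.rTensor_tmul,
      LinearEquiv.coe_coe, comul_mul_eq, assoc_tensorAct]
  | add x y hx hy => simp only [smul_add, map_add, hx, hy]

theorem freeRight_smul (r : V →ₗ[ℂ] V ⊗[ℂ] D) (b : B.toSubalgebra) (x : A ⊗[ℂ] V) :
    freeRight A r (b • x) = b • freeRight A r x := by
  apply (TensorProduct.assoc ℂ A V D).injective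
  rw [assoc_smul]
  simp [freeRight, lTensor_smul]

end Actions

section Cotensor

variable {V : Type*} [AddCommGroup V] [Module ℂ V] (l : V →ₗ[ℂ] B.Quot ⊗[ℂ] V)

theorem rightCoact_coassoc (a : A) :
    B.rightCoact.lTensor A (Coalgebra.comul (R := ℂ) a) =
      TensorProduct.assoc ℂ A A B.Quot
        ((Coalgebra.comul (R := ℂ) (A := A)).rTensor B.Quot (B.rightCoact a)) := by
  have e1 : ∀ y : A ⊗[ℂ] A, TensorProduct.assoc ℂ A A B.Quot
      ((Coalgebra.comul (R := ℂ) (A := A)).rTensor B.Quot (B.proj.lTensor A y)) =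
      (B.proj.lTensor A).lTensor A (TensorProduct.assoc ℂ A A A
        ((Coalgebra.comul (R := ℂ) (A := A)).rTensor A y)) := by
    intro y
    induction y using TensorProduct.induction_on with
    | zero => simp
    | tmul a c =>
      simp only [LinearMap.lTensor_tmul, LinearMap.rTensor_tmul]
      induction Coalgebra.comul (R := ℂ) a using TensorProduct.induction_on with
      | zero => simp
      | tmul x y => simp
      | add x y hx hy => simp only [TensorProduct.add_tmul, map_add, hx, hy]
    | add x y hx hy => simp only [map_add, hx, hy]
  rw [rightCoact, LinearMap.comp_apply, e1, Coalgebra.coassoc_apply, LinearMap.lTensor_comp,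
    LinearMap.comp_apply]

theorem freeLeft_rightCoact (x : A ⊗[ℂ] V) :
    ((TensorProduct.assoc ℂ A B.Quot V).toLinearMap ∘ₗ B.rightCoact.rTensor V).lTensor A
        (freeLeft A V x) =
      freeLeft A (B.Quot ⊗[ℂ] V) (TensorProduct.assoc ℂ A B.Quot V
        (B.rightCoact.rTensor V x)) := by
  have e1 : ∀ (y : A ⊗[ℂ] A) (v : V),
      ((TensorProduct.assoc ℂ A B.Quot V).toLinearMap ∘ₗ B.rightCoact.rTensor V).lTensor A
        (TensorProduct.assoc ℂ A A V (y ⊗ₜ v)) =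
      (TensorProduct.assoc ℂ A B.Quot V).toLinearMap.lTensor A
        (TensorProduct.assoc ℂ A (A ⊗[ℂ] B.Quot) V (B.rightCoact.lTensor A y ⊗ₜ v)) := by
    intro y v
    induction y using TensorProduct.induction_on with
    | zero => simp
    | tmul a c => simp
    | add x y hx hy => simp only [TensorProduct.add_tmul, map_add, hx, hy]
  have e0 : ∀ (y : A ⊗[ℂ] A) (p : B.Quot) (v : V),
      TensorProduct.assoc ℂ A A (B.Quot ⊗[ℂ] V) (y ⊗ₜ (p ⊗ₜ v)) =
      (TensorProduct.assoc ℂ A B.Quot V).toLinearMap.lTensor A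
        (TensorProduct.assoc ℂ A (A ⊗[ℂ] B.Quot) V
          (TensorProduct.assoc ℂ A A B.Quot (y ⊗ₜ p) ⊗ₜ v)) := by
    intro y p v
    induction y using TensorProduct.induction_on with
    | zero => simp
    | tmul a c => simp
    | add x y hx hy => simp only [TensorProduct.add_tmul, map_add, hx, hy]
  have e2 : ∀ (z : A ⊗[ℂ] B.Quot) (v : V),
      freeLeft A (B.Quot ⊗[ℂ] V) (TensorProduct.assoc ℂ A B.Quot V (z ⊗ₜ v)) =
      (TensorProduct.assoc ℂ A B.Quot V).toLinearMap.lTensor A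
        (TensorProduct.assoc ℂ A (A ⊗[ℂ] B.Quot) V
          (TensorProduct.assoc ℂ A A B.Quot
            ((Coalgebra.comul (R := ℂ) (A := A)).rTensor B.Quot z) ⊗ₜ v)) := by
    intro z v
    induction z using TensorProduct.induction_on with
    | zero => simp
    | tmul a c => simp [freeLeft, e0]
    | add x y hx hy => simp only [TensorProduct.add_tmul, map_add, hx, hy]
  induction x using TensorProduct.induction_on with
  | zero => simp
  | tmul a v =>
    refine (e1 _ v).trans ?_
    rw [LinearMap.rTensor_tmul, e2, rightCoact_coassoc]
  | add x y hx hy => rw [map_add, map_add, map_add, map_add, map_add, hx, hy]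

theorem freeRight_rightCoact (r : V →ₗ[ℂ] V ⊗[ℂ] D) (x : A ⊗[ℂ] V) :
    ((TensorProduct.assoc ℂ A B.Quot V).toLinearMap ∘ₗ B.rightCoact.rTensor V).rTensor D
        (freeRight A r x) =
      freeRight A (freeRight B.Quot r) (TensorProduct.assoc ℂ A B.Quot V
        (B.rightCoact.rTensor V x)) := by
  have e1 : ∀ (a : A) (z : V ⊗[ℂ] D),
      ((TensorProduct.assoc ℂ A B.Quot V).toLinearMap ∘ₗ B.rightCoact.rTensor V).rTensor D
        ((TensorProduct.assoc ℂ A V D).symm (a ⊗ₜ z)) =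
      (TensorProduct.assoc ℂ A (B.Quot ⊗[ℂ] V) D).symm
        ((TensorProduct.assoc ℂ B.Quot V D).symm.toLinearMap.lTensor A
          (TensorProduct.assoc ℂ A B.Quot (V ⊗[ℂ] D) (B.rightCoact a ⊗ₜ z))) := by
    intro a z
    induction z using TensorProduct.induction_on with
    | zero => simp
    | tmul v d =>
      simp only [TensorProduct.assoc_symm_tmul, LinearMap.rTensor_tmul, LinearMap.comp_apply,
        LinearEquiv.coe_coe]
      induction B.rightCoact a using TensorProduct.induction_on with
      | zero => simp
      | tmul x y => simp
      | add x y hx hy => simp only [TensorProduct.add_tmul, map_add, hx, hy]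
    | add x y hx hy => simp only [TensorProduct.tmul_add, map_add, hx, hy]
  have e2 : ∀ (y : A ⊗[ℂ] B.Quot) (v : V),
      freeRight A (freeRight B.Quot r) (TensorProduct.assoc ℂ A B.Quot V (y ⊗ₜ v)) =
      (TensorProduct.assoc ℂ A (B.Quot ⊗[ℂ] V) D).symm
        ((TensorProduct.assoc ℂ B.Quot V D).symm.toLinearMap.lTensor A
          (TensorProduct.assoc ℂ A B.Quot (V ⊗[ℂ] D) (y ⊗ₜ r v))) := by
    intro y v
    induction y using TensorProduct.induction_on with
    | zero => simp
    | tmul a c => simp [freeRight]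
    | add x y hx hy => simp only [TensorProduct.add_tmul, map_add, hx, hy]
  induction x using TensorProduct.induction_on with
  | zero => simp
  | tmul a v => exact (e1 a (r v)).trans (e2 _ v).symm
  | add x y hx hy => rw [map_add, map_add, map_add, map_add, map_add, hx, hy]

theorem freeRight_eq_of_commute {r : V →ₗ[ℂ] V ⊗[ℂ] D} (h : CoactionsCommute l r) :
    freeRight B.Quot r ∘ₗ l = l.rTensor D ∘ₗ r := by
  refine LinearMap.ext fun v => ?_
  apply (TensorProduct.assoc ℂ B.Quot V D).injective
  have := LinearMap.congr_fun h v
  simp only [LinearMap.comp_apply, LinearEquiv.coe_coe] at this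
  simp [freeRight, this]

/-- The cotensor product `A □_{π_B} V`. -/
def psiSub : Submodule ℂ (A ⊗[ℂ] V) := cotensor B.rightCoact l

theorem mem_psiSub_iff (x : A ⊗[ℂ] V) : x ∈ B.psiSub l ↔
    TensorProduct.assoc ℂ A B.Quot V (B.rightCoact.rTensor V x) = l.lTensor A x :=
  mem_cotensor_iff _ _ _

theorem smul_mem_psiSub (b : B.toSubalgebra) {x : A ⊗[ℂ] V} (hx : x ∈ B.psiSub l) :
    b • x ∈ B.psiSub l := by
  rw [mem_psiSub_iff] at hx ⊢
  rw [rightCoact_rTensor_smul, assoc_smul, hx, lTensor_smul]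

instance : SMul B.toSubalgebra (B.psiSub l) where
  smul b x := ⟨b • (x : A ⊗[ℂ] V), B.smul_mem_psiSub l b x.2⟩

/-- `B` acts on the first factor of `A □_{π_B} V`. -/
instance psiModule : Module B.toSubalgebra (B.psiSub l) :=
  Function.Injective.module B.toSubalgebra (B.psiSub l).subtype.toAddMonoidHom
    Subtype.val_injective (fun _ _ => rfl)

instance psiScalarTower : IsScalarTower ℂ B.toSubalgebra (B.psiSub l) where
  smul_assoc z b x := Subtype.ext (smul_assoc z b (x : A ⊗[ℂ] V))

/-- The inclusion `A □_{π_B} V → A ⊗ V`. -/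
def psiIncl : B.psiSub l →ₗ[ℂ] A ⊗[ℂ] V := (B.psiSub l).subtype

/-- The inclusion `A □_{π_B} V → A ⊗ V`, as a `B`-linear map. -/
def psiInclB : B.psiSub l →ₗ[B.toSubalgebra] A ⊗[ℂ] V where
  toFun x := x
  map_add' _ _ := rfl
  map_smul' _ _ := rfl

theorem psiIncl_injective : Function.Injective (B.psiIncl l) := Subtype.val_injective

theorem psiIncl_lTensor_injective (X : Type*) [AddCommGroup X] [Module ℂ X] :
    Function.Injective ((B.psiIncl l).lTensor X) :=
  Module.Flat.lTensor_preserves_injective_linearMap _ (B.psiIncl_injective l)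

theorem psiIncl_rTensor_injective (X : Type*) [AddCommGroup X] [Module ℂ X] :
    Function.Injective ((B.psiIncl l).rTensor X) :=
  Module.Flat.rTensor_preserves_injective_linearMap _ (B.psiIncl_injective l)

/-- The left `A`-coaction on `A □_{π_B} V`, given by `Δ` on the first factor. -/
def psiCoact : B.psiSub l →ₗ[ℂ] A ⊗[ℂ] B.psiSub l :=
  LinearMap.codRestrictOfInjective (freeLeft A V ∘ₗ B.psiIncl l) ((B.psiIncl l).lTensor A)
    (B.psiIncl_lTensor_injective l A) <| by
    intro x
    refine mem_range_lTensor _ _ _ ?_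
    have h := LinearMap.congr_fun (freeLeft_lTensor A l) (B.psiIncl l x)
    refine (B.freeLeft_rightCoact _).trans (Eq.trans ?_ h.symm)
    exact congrArg _ x.2

theorem psiIncl_psiCoact :
    (B.psiIncl l).lTensor A ∘ₗ B.psiCoact l = freeLeft A V ∘ₗ B.psiIncl l :=
  LinearMap.codRestrictOfInjective_comp _ _ _ _

/-- The right coaction `id ⊗ Δ_R` on `A □_{π_B} V`. -/
def psiCoactR {r : V →ₗ[ℂ] V ⊗[ℂ] D} (h : CoactionsCommute l r) :
    B.psiSub l →ₗ[ℂ] B.psiSub l ⊗[ℂ] D :=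
  LinearMap.codRestrictOfInjective (freeRight A r ∘ₗ B.psiIncl l) ((B.psiIncl l).rTensor D)
    (B.psiIncl_rTensor_injective l D) <| by
    intro x
    refine mem_range_rTensor _ _ _ ?_
    have h' := LinearMap.congr_fun (freeRight_lTensor A l _ _ (B.freeRight_eq_of_commute l h))
      (B.psiIncl l x)
    refine (B.freeRight_rightCoact _ _).trans (Eq.trans ?_ h'.symm)
    exact congrArg _ x.2

theorem psiIncl_psiCoactR {r : V →ₗ[ℂ] V ⊗[ℂ] D} (h : CoactionsCommute l r) :
    (B.psiIncl l).rTensor D ∘ₗ B.psiCoactR l h = freeRight A r ∘ₗ B.psiIncl l :=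
  LinearMap.codRestrictOfInjective_comp _ _ _ _

theorem psiCoact_smul (b : B.toSubalgebra) (x : B.psiSub l) :
    B.psiCoact l (b • x) = B.tensorAct (B.psiSub l) (B.coact b) (B.psiCoact l x) := by
  apply B.psiIncl_lTensor_injective l A
  have e : ∀ y, (B.psiIncl l).lTensor A (B.psiCoact l y) = freeLeft A V (B.psiIncl l y) :=
    LinearMap.congr_fun (B.psiIncl_psiCoact l)
  have e1 := B.lTensor_tensorAct (F := B.psiSub l) (G := A ⊗[ℂ] V) (B.psiInclB l) (B.coact b)
    (B.psiCoact l x)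
  have e2 : (B.psiInclB l).restrictScalars ℂ = B.psiIncl l := rfl
  have e3 : B.psiIncl l (b • x) = b • B.psiIncl l x := rfl
  rw [e2] at e1
  rw [e1, e, e, e3, freeLeft_smul]

theorem psiCoactR_smul {r : V →ₗ[ℂ] V ⊗[ℂ] D} (h : CoactionsCommute l r)
    (b : B.toSubalgebra) (x : B.psiSub l) :
    B.psiCoactR l h (b • x) = b • B.psiCoactR l h x := by
  apply B.psiIncl_rTensor_injective l D
  have e := LinearMap.congr_fun (B.psiIncl_psiCoactR l h)
  have e1 : ∀ y : B.psiSub l ⊗[ℂ] D,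
      (B.psiIncl l).rTensor D (b • y) = b • (B.psiIncl l).rTensor D y := by
    intro y
    induction y using TensorProduct.induction_on with
    | zero => simp
    | tmul a c =>
      rw [TensorProduct.smul_tmul', LinearMap.rTensor_tmul, LinearMap.rTensor_tmul,
        Subalgebra.smul_def b (_ ⊗ₜ[ℂ] _), TensorProduct.smul_tmul']
      rfl
    | add x y hx hy => simp only [smul_add, map_add, hx, hy]
  refine (e (b • x)).trans ((B.freeRight_smul r b (x : A ⊗[ℂ] V)).trans ?_)
  rw [e1]
  exact congrArg _ (e x).symm

end Cotensor

/-- The map `A □_{π_B} V → A □_{π_B} W` given by `id ⊗ γ`. -/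
def psiMap {V W : LeftComod B.Quot} (γ : V ⟶ W) :
    B.psiSub V.coact →ₗ[B.toSubalgebra] B.psiSub W.coact where
  toFun x := ⟨γ.map.lTensor A x, by
    have hx := x.2
    rw [mem_psiSub_iff] at hx ⊢
    have e1 : (TensorProduct.assoc ℂ A B.Quot W.carrier).toLinearMap ∘ₗ
        B.rightCoact.rTensor W.carrier ∘ₗ γ.map.lTensor A =
        (γ.map.lTensor B.Quot).lTensor A ∘ₗ
          (TensorProduct.assoc ℂ A B.Quot V.carrier).toLinearMap ∘ₗ
          B.rightCoact.rTensor V.carrier := by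
      refine TensorProduct.ext' fun a v => ?_
      simp only [LinearMap.comp_apply, LinearMap.lTensor_tmul, LinearMap.rTensor_tmul,
        LinearEquiv.coe_coe]
      induction B.rightCoact a using TensorProduct.induction_on with
      | zero => simp
      | tmul x y => simp
      | add x y hx hy => simp only [TensorProduct.add_tmul, map_add, hx, hy]
    have e1' := LinearMap.congr_fun e1 (x : A ⊗[ℂ] V.carrier)
    simp only [LinearMap.comp_apply, LinearEquiv.coe_coe] at e1'
    rw [e1', hx, ← LinearMap.lTensor_comp_apply, ← LinearMap.lTensor_comp_apply, γ.comm]⟩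
  map_add' x y := Subtype.ext (by simp)
  map_smul' b x := Subtype.ext (B.lTensor_smul γ.map b _)

theorem psiIncl_psiMap {V W : LeftComod B.Quot} (γ : V ⟶ W) :
    B.psiIncl W.coact ∘ₗ (B.psiMap γ).restrictScalars ℂ =
      γ.map.lTensor A ∘ₗ B.psiIncl V.coact := rfl

theorem psiMap_comm {V W : LeftComod B.Quot} (γ : V ⟶ W) :
    B.psiCoact W.coact ∘ₗ (B.psiMap γ).restrictScalars ℂ =
      ((B.psiMap γ).restrictScalars ℂ).lTensor A ∘ₗ B.psiCoact V.coact := by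
  have e1 := (freeLeft_lTensor A γ.map).symm
  have a1 := B.psiIncl_psiCoact V.coact
  have a2 := B.psiIncl_psiCoact W.coact
  have a3 := congrArg (LinearMap.lTensor A) (B.psiIncl_psiMap γ)
  have a4 := B.psiIncl_psiMap γ
  simp only [LinearMap.lTensor_comp, LinearMap.ext_iff, LinearMap.comp_apply] at e1 a1 a2 a3 a4
  refine LinearMap.ext fun x => B.psiIncl_lTensor_injective W.coact A ?_
  rw [LinearMap.comp_apply, LinearMap.comp_apply, a2, a3, a1, a4, e1]

theorem psiMap_commR {V W : Bicomod B.Quot D} (γ : V ⟶ W) :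
    B.psiCoactR W.coact W.commute ∘ₗ (B.psiMap γ.hom).restrictScalars ℂ =
      ((B.psiMap γ.hom).restrictScalars ℂ).rTensor D ∘ₗ B.psiCoactR V.coact V.commute := by
  have e1 := (freeRight_lTensor A γ.hom.map _ _ γ.commR).symm
  have a1 := B.psiIncl_psiCoactR V.coact V.commute
  have a2 := B.psiIncl_psiCoactR W.coact W.commute
  have a3 := congrArg (LinearMap.rTensor D) (B.psiIncl_psiMap γ.hom)
  have a4 := B.psiIncl_psiMap γ.hom
  simp only [LinearMap.rTensor_comp, LinearMap.ext_iff, LinearMap.comp_apply] at e1 a1 a2 a3 a4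
  refine LinearMap.ext fun x => B.psiIncl_rTensor_injective W.coact D ?_
  rw [LinearMap.comp_apply, LinearMap.comp_apply, a2, a3, a1, a4, e1]

/-- The functor `Ψ(V) = A □_{π_B} V` from left `π_B(A)`-comodules to relative Hopf modules. -/
def Psi : LeftComod B.Quot ⥤ RelHopfMod B where
  obj V :=
    { carrier := B.psiSub V.coact
      coact := B.psiCoact V.coact
      isLeftCoaction := (isLeftCoaction_freeLeft A V.carrier).ofInjective _
        (B.psiIncl_injective _) _ (B.psiIncl_psiCoact _)
      coact_smul := B.psiCoact_smul V.coact }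
  map γ :=
    { map := B.psiMap γ
      comm := B.psiMap_comm γ }
  map_id V := by
    apply RelHopfMod.Hom.ext
    refine LinearMap.ext fun x => Subtype.ext ?_
    exact LinearMap.lTensor_id_apply _ _ _
  map_comp f g := by
    apply RelHopfMod.Hom.ext
    refine LinearMap.ext fun x => Subtype.ext ?_
    exact LinearMap.lTensor_comp_apply _ _ _ _

variable (D) in
/-- The functor `Ψ` on bicomodules. -/
def PsiR : Bicomod B.Quot D ⥤ RelHopfBimod B D where
  obj V :=
    { toRelHopfMod := B.Psi.obj V.toLeftComod
      coactR := B.psiCoactR V.coact V.commute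
      isRightCoaction := (isRightCoaction_freeRight A V.isRightCoaction).ofInjective _
        (B.psiIncl_injective _) _ (B.psiIncl_psiCoactR _ _)
      commute := (coactionsCommute_free A V.coactR).ofInjective _ (B.psiIncl_injective _) _
        (B.psiIncl_psiCoact _) _ (B.psiIncl_psiCoactR _ _)
      coactR_smul := B.psiCoactR_smul V.coact V.commute }
  map γ :=
    { hom := B.Psi.map γ.hom
      commR := B.psiMap_commR γ }
  map_id _ := RelHopfBimod.Hom.ext (B.Psi.map_id _)
  map_comp _ _ := RelHopfBimod.Hom.ext (B.Psi.map_comp _ _)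

end QuantumHomogeneousSpace

/-! ### The unit and the counit -/

namespace QuantumHomogeneousSpace

variable (B : QuantumHomogeneousSpace A)

theorem lTensor_mkQ_coact_mem (F : RelHopfMod B) (f : F.carrier) :
    (B.plusSMul F.carrier).mkQ.lTensor A (F.coact f) ∈ B.psiSub (B.phiCoact F) := by
  rw [mem_psiSub_iff]
  have e1 : ∀ y : A ⊗[ℂ] F.carrier, TensorProduct.assoc ℂ A B.Quot (F.carrier ⧸ B.plusSMul F.carrier)
      (B.rightCoact.rTensor _ ((B.plusSMul F.carrier).mkQ.lTensor A y)) =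
      (TensorProduct.map B.proj (B.plusSMul F.carrier).mkQ).lTensor A
        (TensorProduct.assoc ℂ A A F.carrier
          ((Coalgebra.comul (R := ℂ) (A := A)).rTensor F.carrier y)) := by
    intro y
    induction y using TensorProduct.induction_on with
    | zero => simp
    | tmul a v =>
      simp only [LinearMap.lTensor_tmul, LinearMap.rTensor_tmul, rightCoact, LinearMap.comp_apply]
      induction Coalgebra.comul (R := ℂ) a using TensorProduct.induction_on with
      | zero => simp
      | tmul x y => simp
      | add x y hx hy => simp only [TensorProduct.add_tmul, map_add, hx, hy]
    | add x y hx hy => simp only [map_add, hx, hy]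
  have e2 := LinearMap.congr_fun F.isLeftCoaction.coassoc f
  simp only [LinearMap.comp_apply, LinearEquiv.coe_coe] at e2
  rw [e1, e2, ← LinearMap.lTensor_comp_apply, ← LinearMap.lTensor_comp_apply,
    phiCoact_comp_mkQ]

/-- The map `F → A □_{π_B} (F / B⁺F)`, `f ↦ f₍₋₁₎ ⊗ [f₍₀₎]`. -/
def unitMap (F : RelHopfMod B) :
    F.carrier →ₗ[B.toSubalgebra] B.psiSub (B.phiCoact F) where
  toFun f := ⟨(B.plusSMul F.carrier).mkQ.lTensor A (F.coact f), B.lTensor_mkQ_coact_mem F f⟩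
  map_add' x y := Subtype.ext (by simp)
  map_smul' b f := Subtype.ext (by
    have h := B.map_tensorAct_coact (F := F.carrier) LinearMap.id (B.plusSMul F.carrier).mkQ
      (fun b f => B.mkQ_smul b f) b (F.coact f)
    rw [← F.coact_smul] at h
    exact h.trans (B.lTensor_smul _ b _))

theorem psiIncl_unitMap (F : RelHopfMod B) :
    B.psiIncl (B.phiCoact F) ∘ₗ (B.unitMap F).restrictScalars ℂ =
      (B.plusSMul F.carrier).mkQ.lTensor A ∘ₗ F.coact := rfl

theorem unitMap_comm (F : RelHopfMod B) :
    B.psiCoact (B.phiCoact F) ∘ₗ (B.unitMap F).restrictScalars ℂ =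
      ((B.unitMap F).restrictScalars ℂ).lTensor A ∘ₗ F.coact := by
  have a2 := B.psiIncl_psiCoact (B.phiCoact F)
  have a3 := congrArg (LinearMap.lTensor A) (B.psiIncl_unitMap F)
  have a4 := B.psiIncl_unitMap F
  have a5 := freeLeft_lTensor A (B.plusSMul F.carrier).mkQ
  have a6 := F.isLeftCoaction.coassoc
  simp only [LinearMap.lTensor_comp, LinearMap.ext_iff, LinearMap.comp_apply,
    LinearEquiv.coe_coe] at a2 a3 a4 a5 a6
  refine LinearMap.ext fun x => B.psiIncl_lTensor_injective (B.phiCoact F) A ?_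
  rw [LinearMap.comp_apply, LinearMap.comp_apply, a2, a3, a4, ← a5, ← a6]
  rfl

/-- The unit of the equivalence between relative Hopf modules and left `π_B(A)`-comodules, with
components `f ↦ f₍₋₁₎ ⊗ [f₍₀₎]`. -/
def takUnit : 𝟭 (RelHopfMod B) ⟶ B.Phi ⋙ B.Psi where
  app F :=
    { map := B.unitMap F
      comm := B.unitMap_comm F }
  naturality F G f := by
    apply RelHopfMod.Hom.ext
    refine LinearMap.ext fun x => Subtype.ext ?_
    have h1 : G.coact (f.map x) = (f.map.restrictScalars ℂ).lTensor A (F.coact x) :=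
      LinearMap.congr_fun f.comm x
    have h2 := B.phiMap_comp_mkQ f.map
    change (B.plusSMul G.carrier).mkQ.lTensor A (G.coact (f.map x)) =
      (B.phiMap f.map).lTensor A ((B.plusSMul F.carrier).mkQ.lTensor A (F.coact x))
    rw [h1, ← LinearMap.lTensor_comp_apply, ← LinearMap.lTensor_comp_apply, h2]

/-- The map `A ⊗ V → V`, `a ⊗ v ↦ ε(a) v`. -/
def counitTensor (V : Type*) [AddCommGroup V] [Module ℂ V] : A ⊗[ℂ] V →ₗ[ℂ] V :=
  (TensorProduct.lid ℂ V).toLinearMap ∘ₗ (Coalgebra.counit (R := ℂ) (A := A)).rTensor V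

theorem counitTensor_tmul {V : Type*} [AddCommGroup V] [Module ℂ V] (a : A) (v : V) :
    counitTensor V (a ⊗ₜ[ℂ] v) = Coalgebra.counit (R := ℂ) a • v := by
  simp [counitTensor]

/-- The inclusion `Ψ(V) → A ⊗ V`. -/
def psiObjIncl (V : LeftComod B.Quot) : (B.Psi.obj V).carrier →ₗ[ℂ] A ⊗[ℂ] V.carrier :=
  B.psiIncl V.coact

theorem psiObjIncl_smul (V : LeftComod B.Quot) (b : B.toSubalgebra) (x : (B.Psi.obj V).carrier) :
    B.psiObjIncl V (b • x) = b • B.psiObjIncl V x := rfl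

theorem psiObjIncl_mem (V : LeftComod B.Quot) (x : (B.Psi.obj V).carrier) :
    B.psiObjIncl V x ∈ B.psiSub V.coact := Subtype.property (p := (· ∈ B.psiSub V.coact)) x

theorem psiObjIncl_coact (V : LeftComod B.Quot) (x : (B.Psi.obj V).carrier) :
    (B.psiObjIncl V).lTensor A ((B.Psi.obj V).coact x) = freeLeft A V.carrier (B.psiObjIncl V x) :=
  LinearMap.congr_fun (B.psiIncl_psiCoact V.coact) x

/-- The map `Φ(Ψ(V)) = (A □_{π_B} V) / B⁺(A □_{π_B} V) → V`, `[∑ aᵢ ⊗ vᵢ] ↦ ∑ ε(aᵢ) vᵢ`. -/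
def counitMap (V : LeftComod B.Quot) :
    (B.Psi.obj V).carrier ⧸ B.plusSMul (B.Psi.obj V).carrier →ₗ[ℂ] V.carrier :=
  (B.plusSMul (B.Psi.obj V).carrier).liftQ (counitTensor V.carrier ∘ₗ B.psiObjIncl V) <| by
    rw [plusSMul, Submodule.span_le]
    rintro _ ⟨b, x, hb, rfl⟩
    have h : ∀ y : A ⊗[ℂ] V.carrier, counitTensor V.carrier (b • y) = 0 := by
      intro y
      induction y using TensorProduct.induction_on with
      | zero => simp
      | tmul a v =>
        rw [smul_tmul_eq, counitTensor_tmul, Bialgebra.counit_mul, B.counit_eq_zero_of_mem hb,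
          zero_mul, zero_smul]
      | add x y hx hy => rw [smul_add, map_add, hx, hy, add_zero]
    rw [SetLike.mem_coe, LinearMap.mem_ker, LinearMap.comp_apply, psiObjIncl_smul, h]

theorem counitMap_mkQ (V : LeftComod B.Quot) (x : (B.Psi.obj V).carrier) :
    B.counitMap V ((B.plusSMul (B.Psi.obj V).carrier).mkQ x) =
      counitTensor V.carrier (B.psiObjIncl V x) := rfl

theorem counitMap_comm (V : LeftComod B.Quot) :
    V.coact ∘ₗ B.counitMap V =
      (B.counitMap V).lTensor B.Quot ∘ₗ B.phiCoact (B.Psi.obj V) := by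
  rw [← LinearMap.cancel_right (Submodule.mkQ_surjective (B.plusSMul (B.Psi.obj V).carrier))]
  refine LinearMap.ext fun x => ?_
  have h2 : B.phiCoact (B.Psi.obj V) ((B.plusSMul (B.Psi.obj V).carrier).mkQ x) =
      TensorProduct.map B.proj (B.plusSMul (B.Psi.obj V).carrier).mkQ ((B.Psi.obj V).coact x) :=
    LinearMap.congr_fun (B.phiCoact_comp_mkQ (B.Psi.obj V)) x
  have h3 : ∀ y : A ⊗[ℂ] (B.Psi.obj V).carrier, (B.counitMap V).lTensor B.Quot
      (TensorProduct.map B.proj (B.plusSMul (B.Psi.obj V).carrier).mkQ y) =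
      TensorProduct.map B.proj (counitTensor V.carrier)
        ((B.psiObjIncl V).lTensor A y) := by
    intro y
    induction y using TensorProduct.induction_on with
    | zero => simp
    | tmul a v =>
      rw [TensorProduct.map_tmul, LinearMap.lTensor_tmul, LinearMap.lTensor_tmul,
        TensorProduct.map_tmul, counitMap_mkQ]
    | add x y hx hy => simp only [map_add, hx, hy]
  have h5 : ∀ y : A ⊗[ℂ] V.carrier, TensorProduct.map B.proj (counitTensor V.carrier)
      (freeLeft A V.carrier y) = counitTensor (B.Quot ⊗[ℂ] V.carrier)
        (TensorProduct.assoc ℂ A B.Quot V.carrier (B.rightCoact.rTensor V.carrier y)) := by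
    intro y
    induction y using TensorProduct.induction_on with
    | zero => simp
    | tmul a v =>
      have k1 : ∀ z : A ⊗[ℂ] A, TensorProduct.map B.proj (counitTensor V.carrier)
          (TensorProduct.assoc ℂ A A V.carrier (z ⊗ₜ v)) =
          B.proj (TensorProduct.rid ℂ A
            ((Coalgebra.counit (R := ℂ) (A := A)).lTensor A z)) ⊗ₜ v := by
        intro z
        induction z using TensorProduct.induction_on with
        | zero => simp
        | tmul a c => simp [counitTensor_tmul, TensorProduct.smul_tmul']
        | add x y hx hy => simp only [TensorProduct.add_tmul, map_add, hx, hy]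
      have k2 : ∀ z : A ⊗[ℂ] A, counitTensor (B.Quot ⊗[ℂ] V.carrier)
          (TensorProduct.assoc ℂ A B.Quot V.carrier (B.proj.lTensor A z ⊗ₜ v)) =
          B.proj (TensorProduct.lid ℂ A
            ((Coalgebra.counit (R := ℂ) (A := A)).rTensor A z)) ⊗ₜ v := by
        intro z
        induction z using TensorProduct.induction_on with
        | zero => simp
        | tmul a c => simp [counitTensor_tmul, TensorProduct.smul_tmul']
        | add x y hx hy => simp only [TensorProduct.add_tmul, map_add, hx, hy]
      refine (k1 (Coalgebra.comul (R := ℂ) a)).trans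
        (Eq.trans ?_ (k2 (Coalgebra.comul (R := ℂ) a)).symm)
      simp
    | add x y hx hy => simp only [map_add, hx, hy]
  have h6 : ∀ y : A ⊗[ℂ] V.carrier, counitTensor (B.Quot ⊗[ℂ] V.carrier)
      (V.coact.lTensor A y) = V.coact (counitTensor V.carrier y) := by
    intro y
    induction y using TensorProduct.induction_on with
    | zero => simp
    | tmul a v => simp [counitTensor_tmul]
    | add x y hx hy => simp only [map_add, hx, hy]
  have h7 := (B.mem_psiSub_iff V.coact _).1 (B.psiObjIncl_mem V x)
  rw [LinearMap.comp_apply, LinearMap.comp_apply, LinearMap.comp_apply, LinearMap.comp_apply,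
    h2, h3, psiObjIncl_coact, h5, h7, h6, counitMap_mkQ]

/-- The counit of the equivalence between relative Hopf modules and left `π_B(A)`-comodules, with
components `[∑ aᵢ ⊗ vᵢ] ↦ ∑ ε(aᵢ) vᵢ`. -/
def takCounit : B.Psi ⋙ B.Phi ⟶ 𝟭 (LeftComod B.Quot) where
  app V :=
    { map := B.counitMap V
      comm := B.counitMap_comm V }
  naturality V W γ := by
    apply LeftComod.Hom.ext
    apply Submodule.linearMap_qext
    refine LinearMap.ext fun x => ?_
    have h : ∀ y : A ⊗[ℂ] V.carrier, counitTensor W.carrier (γ.map.lTensor A y) =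
        γ.map (counitTensor V.carrier y) := by
      intro y
      induction y using TensorProduct.induction_on with
      | zero => simp
      | tmul a v => simp [counitTensor_tmul]
      | add x y hx hy => simp only [map_add, hx, hy]
    exact h (B.psiObjIncl V x)

end QuantumHomogeneousSpace

end QHS

end NestedQHS

end

/-! The argument is faithfully flat descent along `B → A`, after which the right coaction is carried
along. Write `C = π_B(A)`.

Two comparison maps become bijective after base change. For a relative Hopf module `F`, the
canonical map `can : A ⊗_B F → A ⊗ F/B⁺F`, `a ⊗ f ↦ a f₍₋₁₎ ⊗ [f₍₀₎]`, is bijective: the antipode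
gives the inverse `a ⊗ [f] ↦ a S(f₍₋₁₎) ⊗ f₍₀₎` (`can_bijective`). For a left `C`-comodule `V`,
multiplication `psiMul : A ⊗_B (A □_C V) → A ⊗ V` is bijective (`psiMul_bijective`). Indeed `A □_C
V` is the kernel of a `B`-linear map `A ⊗ V → A ⊗ C ⊗ V`; flatness keeps this sequence exact, and
`can` for the free modules `A ⊗ V` and `A ⊗ C ⊗ V` turns it into `A` tensored with the kernel of `Δ
⊗ id - id ⊗ l` on `C ⊗ V`. That kernel contains `l(V)`, and `l` is injective, which is all that is
needed.

Both bijections meet in two triangles. For the unit, `psiMul ∘ (A ⊗_B U) = can`, so `A ⊗_B U` is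
bijective and faithful flatness over `B` gives the same for `U`. For the counit, `(A ⊗ C_V) ∘ can =
psiMul`, so `A ⊗ C_V` is bijective, and a nonzero complex vector space detects bijectivity.

The right coaction adds little. `U` respects it because the left and right coactions of `F` commute;
`C_V` respects it because `ε` acts on the `A`-factor only. Naturality and the triangle identities
are equalities of underlying maps, and a bijective morphism has an inverse compatible with all
coactions. This works for right coactions of any coalgebra `D`; the theorem takes `D = P.Quot`. -/

noncomputable section

namespace NestedQHS

/-! ### Twisting `A ⊗ M` by a left coaction: convolution becomes composition -/

section Twist

variable {A : Type u} [Ring A] [HopfAlgebra ℂ A]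
variable {M : Type*} [AddCommGroup M] [Module ℂ M]

/-- The map `a ⊗ m ↦ a g(m₍₋₁₎) ⊗ m₍₀₎` on `A ⊗ M`, for a left coaction on `M`. -/
def twist (g : A →ₗ[ℂ] A) (ρ : M →ₗ[ℂ] A ⊗[ℂ] M) : A ⊗[ℂ] M →ₗ[ℂ] A ⊗[ℂ] M :=
  (LinearMap.mul' ℂ A).rTensor M ∘ₗ (TensorProduct.assoc ℂ A A M).symm.toLinearMap ∘ₗ
    (g.rTensor M ∘ₗ ρ).lTensor A

theorem mul'_rTensor_assoc_symm (a : A) (y : A ⊗[ℂ] M) :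
    (LinearMap.mul' ℂ A).rTensor M ((TensorProduct.assoc ℂ A A M).symm (a ⊗ₜ y)) = a • y := by
  induction y using TensorProduct.induction_on with
  | zero => simp
  | tmul c m => simp [TensorProduct.smul_tmul']
  | add x y hx hy => simp only [TensorProduct.tmul_add, smul_add, map_add, hx, hy]

theorem twist_tmul (g : A →ₗ[ℂ] A) (ρ : M →ₗ[ℂ] A ⊗[ℂ] M) (a : A) (m : M) :
    twist g ρ (a ⊗ₜ m) = a • g.rTensor M (ρ m) := by
  simp [twist, mul'_rTensor_assoc_symm]

theorem twist_smul (g : A →ₗ[ℂ] A) (ρ : M →ₗ[ℂ] A ⊗[ℂ] M) (a : A) (y : A ⊗[ℂ] M) :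
    twist g ρ (a • y) = a • twist g ρ y := by
  induction y using TensorProduct.induction_on with
  | zero => simp
  | tmul c m => simp [TensorProduct.smul_tmul', twist_tmul, mul_smul]
  | add x y hx hy => simp only [smul_add, map_add, hx, hy]

/-- By coassociativity both sides send `a ⊗ m` to `a h(m₍₋₂₎) g(m₍₋₁₎) ⊗ m₍₀₎`. Thus `twist` turns
the convolution product `h * g` into a composite in reversed order, and convolution inverses into
inverse maps. -/
theorem twist_twist {ρ : M →ₗ[ℂ] A ⊗[ℂ] M} (hρ : IsLeftCoaction ρ) (g h : A →ₗ[ℂ] A)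
    (y : A ⊗[ℂ] M) : twist g ρ (twist h ρ y) =
      twist (LinearMap.mul' ℂ A ∘ₗ TensorProduct.map h g ∘ₗ Coalgebra.comul) ρ y := by
  have e1 : ∀ y : A ⊗[ℂ] M, twist g ρ (h.rTensor M y) =
      (LinearMap.mul' ℂ A ∘ₗ TensorProduct.map h g).rTensor M
        ((TensorProduct.assoc ℂ A A M).symm (ρ.lTensor A y)) := by
    intro y
    induction y using TensorProduct.induction_on with
    | zero => simp
    | tmul c m =>
      rw [LinearMap.rTensor_tmul, twist_tmul, LinearMap.lTensor_tmul]
      induction ρ m using TensorProduct.induction_on with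
      | zero => simp
      | tmul d n => simp [TensorProduct.smul_tmul']
      | add x y hx hy => simp only [TensorProduct.tmul_add, smul_add, map_add, hx, hy]
    | add x y hx hy => simp only [map_add, hx, hy]
  induction y using TensorProduct.induction_on with
  | zero => simp
  | tmul a m =>
    have hc := LinearMap.congr_fun hρ.coassoc m
    simp only [LinearMap.comp_apply, LinearEquiv.coe_coe] at hc
    rw [twist_tmul, twist_tmul, twist_smul, e1, ← hc, LinearEquiv.symm_apply_apply,
      ← LinearMap.rTensor_comp_apply, LinearMap.comp_assoc]
  | add x y hx hy => simp only [map_add, hx, hy]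

theorem twist_counit {ρ : M →ₗ[ℂ] A ⊗[ℂ] M} (hρ : IsLeftCoaction ρ) (y : A ⊗[ℂ] M) :
    twist (Algebra.linearMap ℂ A ∘ₗ Coalgebra.counit) ρ y = y := by
  induction y using TensorProduct.induction_on with
  | zero => simp
  | tmul a m =>
    have hc := LinearMap.congr_fun hρ.counit m
    simp only [LinearMap.comp_apply] at hc
    rw [twist_tmul, LinearMap.rTensor_comp_apply, hc]
    simp [TensorProduct.smul_tmul']
  | add x y hx hy => simp only [map_add, hx, hy]

/-- The antipode axiom `S * id = ηε`, transported by `twist_twist`; `ηε` acts as the identity by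
`twist_counit`. -/
theorem twist_id_twist_antipode {ρ : M →ₗ[ℂ] A ⊗[ℂ] M} (hρ : IsLeftCoaction ρ)
    (y : A ⊗[ℂ] M) :
    twist LinearMap.id ρ (twist (HopfAlgebra.antipode ℂ) ρ y) = y := by
  rw [twist_twist hρ]
  refine Eq.trans ?_ (twist_counit hρ y)
  congr 1
  exact congrArg (twist · ρ) HopfAlgebra.mul_antipode_rTensor_comul

/-- The other antipode axiom, `id * S = ηε`. -/
theorem twist_antipode_twist_id {ρ : M →ₗ[ℂ] A ⊗[ℂ] M} (hρ : IsLeftCoaction ρ)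
    (y : A ⊗[ℂ] M) :
    twist (HopfAlgebra.antipode ℂ) ρ (twist LinearMap.id ρ y) = y := by
  rw [twist_twist hρ]
  refine Eq.trans ?_ (twist_counit hρ y)
  congr 1
  exact congrArg (twist · ρ) HopfAlgebra.mul_antipode_lTensor_comul

theorem lTensor_smul_eq_map {N : Type*} [AddCommGroup N] [Module ℂ N] (q : M →ₗ[ℂ] N) (a : A)
    (z : A ⊗[ℂ] M) :
    q.lTensor A (a • z) = TensorProduct.map (LinearMap.mulLeft ℂ a) q z := by
  induction z using TensorProduct.induction_on with
  | zero => simp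
  | tmul c m => simp [TensorProduct.smul_tmul']
  | add x y hx hy => simp only [smul_add, map_add, hx, hy]

theorem lTensor_left_smul {N : Type*} [AddCommGroup N] [Module ℂ N] (q : M →ₗ[ℂ] N) (a : A)
    (z : A ⊗[ℂ] M) : q.lTensor A (a • z) = a • q.lTensor A z := by
  induction z using TensorProduct.induction_on with
  | zero => simp
  | tmul c m => simp [TensorProduct.smul_tmul']
  | add x y hx hy => simp only [smul_add, map_add, hx, hy]

end Twist

/-! ### Faithful flatness detects injectivity, surjectivity and bijectivity -/

section FaithfullyFlat

variable {A : Type u} [Ring A] [Algebra ℂ A] {B : Subalgebra ℂ A}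
variable {M N Q : Type u} [AddCommGroup M] [Module ℂ M] [Module B M] [IsScalarTower ℂ B M]
  [AddCommGroup N] [Module ℂ N] [Module B N] [IsScalarTower ℂ B N]
  [AddCommGroup Q] [Module ℂ Q] [Module B Q] [IsScalarTower ℂ B Q]

theorem BalancedTensor.map_mk (f : M →ₗ[B] N) (x : A ⊗[ℂ] M) :
    BalancedTensor.map B f ((balancingRelations B M).mkQ x) =
      (balancingRelations B N).mkQ ((f.restrictScalars ℂ).lTensor A x) := rfl

theorem BalancedTensor.map_zero (x : BalancedTensor B M) :
    BalancedTensor.map B (0 : M →ₗ[B] N) x = 0 := by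
  obtain ⟨x, rfl⟩ := Submodule.mkQ_surjective _ x
  rw [BalancedTensor.map_mk]
  have : ((0 : M →ₗ[B] N).restrictScalars ℂ) = 0 := rfl
  simp [this]

/-- Stated for any vanishing map out of a nonempty type, so that it covers both `0 → M → N` and its
base change without identifying `A ⊗_B 0` with zero. -/
theorem exact_zero_left_iff_injective {R X Y Z : Type*} [Ring R] [AddCommGroup X] [Module R X]
    [AddCommGroup Y] [Module R Y] [Zero Z] {i : Z → X} (hi : ∀ z, i z = 0) [Nonempty Z]
    (f : X →ₗ[R] Y) :
    Function.Exact i f ↔ Function.Injective f := by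
  rw [injective_iff_map_eq_zero]
  constructor
  · intro h x hx
    obtain ⟨z, rfl⟩ := (h x).1 hx
    exact hi z
  · intro h x
    constructor
    · intro hx
      exact ⟨Classical.arbitrary Z, by rw [hi, h x hx]⟩
    · rintro ⟨z, rfl⟩
      rw [hi, _root_.map_zero]

theorem exact_zero_right_iff_surjective {X Y Z : Type*} [Zero Z] {p : Y → Z}
    (hp : ∀ y, p y = 0) (f : X → Y) :
    Function.Exact f p ↔ Function.Surjective f :=
  ⟨fun h y => (h y).1 (hp y), fun h y => ⟨fun _ => h y, fun _ => hp y⟩⟩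

/-- Faithful flatness applied to `0 → M → N`, with `PUnit` as the zero module in the required
universe. -/
theorem IsFaithfullyFlatRight.injective_iff (h : IsFaithfullyFlatRight B) (f : M →ₗ[B] N) :
    Function.Injective (BalancedTensor.map B f) ↔ Function.Injective f := by
  have e := h PUnit M N 0 f
  rw [exact_zero_left_iff_injective (fun _ => LinearMap.zero_apply _) f,
    exact_zero_left_iff_injective BalancedTensor.map_zero] at e
  exact e.symm

theorem IsFaithfullyFlatRight.surjective_iff (h : IsFaithfullyFlatRight B) (f : M →ₗ[B] N) :
    Function.Surjective (BalancedTensor.map B f) ↔ Function.Surjective f := by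
  have e := h M N PUnit f 0
  rw [exact_zero_right_iff_surjective (fun _ => LinearMap.zero_apply _) f,
    exact_zero_right_iff_surjective BalancedTensor.map_zero] at e
  exact e.symm

theorem IsFaithfullyFlatRight.bijective_iff (h : IsFaithfullyFlatRight B) (f : M →ₗ[B] N) :
    Function.Bijective (BalancedTensor.map B f) ↔ Function.Bijective f :=
  and_congr (h.injective_iff f) (h.surjective_iff f)

end FaithfullyFlat

/-! ### The canonical map `A ⊗_B F → A ⊗ F/B⁺F` is bijective -/

section Canonical

variable {A : Type u} [Ring A] [HopfAlgebra ℂ A]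

namespace QuantumHomogeneousSpace

variable (B : QuantumHomogeneousSpace A)

/-- The antipode axiom `S(b₍₁₎) b₍₂₎ = ε(b)`, with the second leg kept in `B` so that it can be
moved across `⊗_B`. -/
theorem mul'_antipode_coact (b : B.toSubalgebra) :
    LinearMap.mul' ℂ A (TensorProduct.map (HopfAlgebra.antipode ℂ) B.incl (B.coact b)) =
      algebraMap ℂ A (Coalgebra.counit (R := ℂ) (b : A)) := by
  rw [← HopfAlgebra.mul_antipode_rTensor_comul_apply (R := ℂ) (b : A), ← B.incl_coact,
    ← LinearMap.comp_apply (LinearMap.rTensor A _), LinearMap.rTensor_comp_lTensor]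

section

variable (F : RelHopfMod B) {Q : Type u} [AddCommGroup Q] [Module ℂ Q] (q : F.carrier →ₗ[ℂ] Q)

/-- The map `A ⊗_B F → A ⊗ Q`, `a ⊗ f ↦ a f₍₋₁₎ ⊗ q(f₍₀₎)`, for a linear map `q : F → Q` with
kernel `B⁺F`. -/
def can (hq : LinearMap.ker q = B.plusSMul F.carrier) :
    BalancedTensor B.toSubalgebra F.carrier →ₗ[ℂ] A ⊗[ℂ] Q :=
  (balancingRelations B.toSubalgebra F.carrier).liftQ
    (q.lTensor A ∘ₗ twist LinearMap.id F.coact) <| by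
    rw [balancingRelations, Submodule.span_le]
    rintro _ ⟨a, b, f, rfl⟩
    -- `bf - ε(b)f` lies in `B⁺F = ker q`, so `B` acts on the image of `q` through `ε`.
    have h1 : ∀ (b : B.toSubalgebra) (f : F.carrier),
        q (b • f) = Coalgebra.counit (R := ℂ) (b : A) • q f := by
      intro b f
      have h := B.mkQ_smul b f
      rwa [← map_smul (B.plusSMul F.carrier).mkQ, ← sub_eq_zero, ← map_sub, Submodule.mkQ_apply,
        Submodule.Quotient.mk_eq_zero, ← hq, LinearMap.mem_ker, map_sub, map_smul q,
        sub_eq_zero] at h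
    -- `a b₍₁₎ f₍₋₁₎ ⊗ q(b₍₂₎ f₍₀₎) = a b f₍₋₁₎ ⊗ q(f₍₀₎)`: the counit absorbs `b₍₂₎`, so the two
    -- sides of a balancing relation have the same image.
    have h2 := B.map_tensorAct_coact (LinearMap.mulLeft ℂ a) q h1 b (F.coact f)
    rw [← F.coact_smul, ← lTensor_smul_eq_map, ← lTensor_smul_eq_map, Subalgebra.smul_def,
      ← mul_smul] at h2
    rw [SetLike.mem_coe, LinearMap.mem_ker, map_sub, LinearMap.comp_apply, LinearMap.comp_apply,
      twist_tmul, twist_tmul, LinearMap.rTensor_id_apply, LinearMap.rTensor_id_apply, h2, sub_self]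

variable {F q}

theorem can_mk (hq : LinearMap.ker q = B.plusSMul F.carrier) (x : A ⊗[ℂ] F.carrier) :
    B.can F q hq ((balancingRelations B.toSubalgebra F.carrier).mkQ x) =
      q.lTensor A (twist LinearMap.id F.coact x) := rfl

theorem can_mk_tmul (hq : LinearMap.ker q = B.plusSMul F.carrier) (a : A) (f : F.carrier) :
    B.can F q hq ((balancingRelations B.toSubalgebra F.carrier).mkQ (a ⊗ₜ f)) =
      a • q.lTensor A (F.coact f) := by
  rw [can_mk, twist_tmul, LinearMap.rTensor_id_apply, lTensor_left_smul]

/-- In `A ⊗_B F` one computes `a S(b₍₁₎f₍₋₁₎) ⊗ b₍₂₎f₍₀₎ = a S(f₍₋₁₎) S(b₍₁₎) b₍₂₎ ⊗ f₍₀₎ = ε(b) a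
S(f₍₋₁₎) ⊗ f₍₀₎`. Hence the antipode twist kills `A ⊗ B⁺F` modulo the balancing relations, which
makes it induce an inverse to `can`. -/
theorem mkQ_twist_antipode_smul (a : A) (b : B.toSubalgebra) (f : F.carrier) :
    (balancingRelations B.toSubalgebra F.carrier).mkQ
        (twist (HopfAlgebra.antipode ℂ) F.coact (a ⊗ₜ (b • f))) =
      Coalgebra.counit (R := ℂ) (b : A) • (balancingRelations B.toSubalgebra F.carrier).mkQ
        (twist (HopfAlgebra.antipode ℂ) F.coact (a ⊗ₜ f)) := by
  -- The coaction of `b` is replaced by an arbitrary `w ∈ A ⊗ B`, so that both sides are bilinear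
  -- and can be checked on `w = c ⊗ b`, `y = d ⊗ f`. Only afterwards does `w = B.coact b` bring in
  -- the antipode axiom.
  have e : ∀ (y : A ⊗[ℂ] F.carrier) (w : A ⊗[ℂ] B.toSubalgebra) ,
      (balancingRelations B.toSubalgebra F.carrier).mkQ
        (a • (HopfAlgebra.antipode ℂ).rTensor F.carrier (B.tensorAct F.carrier w y)) =
      (balancingRelations B.toSubalgebra F.carrier).mkQ
        (TensorProduct.map (LinearMap.mulRight ℂ (LinearMap.mul' ℂ A
          (TensorProduct.map (HopfAlgebra.antipode ℂ) B.incl w)) ∘ₗ LinearMap.mulLeft ℂ a ∘ₗ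
            HopfAlgebra.antipode ℂ) LinearMap.id y) := by
    intro y w
    induction w using TensorProduct.induction_on with
    | zero => simp
    | tmul c b =>
      induction y using TensorProduct.induction_on with
      | zero => simp
      | tmul d f =>
        rw [← sub_eq_zero, ← map_sub, Submodule.mkQ_apply, Submodule.Quotient.mk_eq_zero,
          ← neg_mem_iff, neg_sub]
        -- Since `S(cd) = S(d)S(c)`, the difference is the relation that moves `b` past the tensor
        -- sign with coefficient `a S(d) S(c)`; the sign was flipped to match the orientation of the
        -- generators.
        refine Submodule.subset_span ⟨a * HopfAlgebra.antipode ℂ d * HopfAlgebra.antipode ℂ c,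
          b, f, ?_⟩
        simp [TensorProduct.smul_tmul', HopfAlgebra.antipode_mul_antidistrib, mul_assoc]
      | add x y hx hy => simp only [map_add, smul_add] at hx hy ⊢; rw [hx, hy]
    | add x z hx hz =>
      have h : ∀ c d : A, LinearMap.mulRight ℂ (c + d) =
          LinearMap.mulRight ℂ c + LinearMap.mulRight ℂ d := fun c d => by
        ext; simp [mul_add]
      simp only [map_add, LinearMap.add_apply, smul_add, hx, hz, h, LinearMap.add_comp,
        TensorProduct.map_add_left]
  rw [twist_tmul, F.coact_smul, e, mul'_antipode_coact, ← map_smul]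
  congr 1
  rw [twist_tmul]
  induction F.coact f using TensorProduct.induction_on with
  | zero => simp
  -- The scalar `ε(b)` arrives as a right factor in `A` and is moved out by centrality.
  | tmul d f => simp [TensorProduct.smul_tmul', Algebra.smul_def, Algebra.commutes]
  | add x y hx hy => simp only [map_add, smul_add, hx, hy]

/-- The twists by `id` and by `S` are mutually inverse on `A ⊗ F`. The first induces `can`, and the
second sends `A ⊗ ker q` into the balancing relations. -/
theorem can_bijective (hq : LinearMap.ker q = B.plusSMul F.carrier)
    (hs : Function.Surjective q) : Function.Bijective (B.can F q hq) := by
  constructor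
  · rw [injective_iff_map_eq_zero]
    intro z hz
    obtain ⟨x, rfl⟩ := Submodule.mkQ_surjective _ z
    rw [can_mk] at hz
    -- By right exactness of `A ⊗ -`, the `id`-twist of `x` comes from `A ⊗ ker q`. Applying the
    -- antipode twist recovers `x`, so it suffices to treat `a ⊗ k` with `k ∈ B⁺F`.
    obtain ⟨y, hy⟩ := (lTensor_exact A (LinearMap.exact_subtype_ker_map q) hs _).1 hz
    rw [← twist_antipode_twist_id F.isLeftCoaction x, ← hy]
    clear hz hy
    induction y using TensorProduct.induction_on with
    | zero => simp
    | tmul a k =>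
      obtain ⟨k, hk⟩ := k
      rw [LinearMap.lTensor_tmul, Submodule.subtype_apply]
      simp only
      rw [hq] at hk
      induction hk using Submodule.span_induction with
      | mem k hk =>
        obtain ⟨b, f, hb, rfl⟩ := hk
        rw [mkQ_twist_antipode_smul, B.counit_eq_zero_of_mem hb, zero_smul]
      | zero => simp
      | add x y _ _ hx hy => rw [TensorProduct.tmul_add, map_add, map_add, hx, hy, add_zero]
      | smul c x _ hx => rw [TensorProduct.tmul_smul, map_smul, map_smul, hx, smul_zero]
    | add x y hx hy => rw [map_add, map_add, map_add, hx, hy, add_zero]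
  · intro y
    obtain ⟨t, rfl⟩ := LinearMap.lTensor_surjective A hs y
    refine ⟨(balancingRelations B.toSubalgebra F.carrier).mkQ
      (twist (HopfAlgebra.antipode ℂ) F.coact t), ?_⟩
    rw [can_mk, twist_id_twist_antipode F.isLeftCoaction]

end

end QuantumHomogeneousSpace

end Canonical

/-- The counit provides a linear retraction of `l`. -/
theorem IsLeftCoaction.injective {C V : Type*} [AddCommMonoid C] [Module ℂ C] [Coalgebra ℂ C]
    [AddCommMonoid V] [Module ℂ V] {l : V →ₗ[ℂ] C ⊗[ℂ] V} (h : IsLeftCoaction l) :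
    Function.Injective l := by
  intro x y hxy
  have hx := LinearMap.congr_fun h.counit x
  have hy := LinearMap.congr_fun h.counit y
  rw [LinearMap.comp_apply] at hx hy
  rw [hxy, hy] at hx
  simpa using congrArg (TensorProduct.lid ℂ V) hx.symm

namespace QuantumHomogeneousSpace

variable {A : Type u} [Ring A] [HopfAlgebra ℂ A] (B : QuantumHomogeneousSpace A)

/-! ### The canonical map for the free modules `A ⊗ V` -/

section Free

variable (V : Type u) [AddCommGroup V] [Module ℂ V]

/-- The relative Hopf module `A ⊗ V`. -/
def free : RelHopfMod B where
  carrier := A ⊗[ℂ] V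
  coact := freeLeft A V
  isLeftCoaction := isLeftCoaction_freeLeft A V
  coact_smul := B.freeLeft_smul

/-- The kernel of `π_B ⊗ id` is the image of `B⁺A ⊗ V`, spanned by elements `ba ⊗ v = b(a ⊗ v)` with
`b ∈ B⁺`. This identifies `Φ(A ⊗ V)` with `π_B(A) ⊗ V`, which is why `can` is set up for a general
`q` with kernel `B⁺F`. -/
theorem ker_proj_rTensor :
    LinearMap.ker (B.proj.rTensor V) = B.plusSMul (A ⊗[ℂ] V) := by
  have h0 : LinearMap.ker B.proj = B.plusIdeal := Submodule.ker_mkQ _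
  apply le_antisymm
  · intro x hx
    obtain ⟨y, rfl⟩ := (rTensor_exact V (LinearMap.exact_subtype_ker_map B.proj)
      (Submodule.mkQ_surjective B.plusIdeal) x).1 hx
    clear hx
    induction y using TensorProduct.induction_on with
    | zero => simp
    | tmul k v =>
      obtain ⟨k, hk⟩ := k
      rw [LinearMap.rTensor_tmul, Submodule.subtype_apply]
      simp only
      rw [h0] at hk
      refine Submodule.mul_induction_on hk (fun b hb a _ => ?_) (fun x y hx hy => ?_)
      · exact Submodule.subset_span ⟨⟨b, hb.1⟩, a ⊗ₜ v, hb, (B.smul_tmul_eq ⟨b, hb.1⟩ a v).symm⟩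
      · rw [TensorProduct.add_tmul]
        exact add_mem hx hy
    | add x y hx hy => rw [map_add]; exact add_mem hx hy
  · rw [plusSMul, Submodule.span_le]
    rintro _ ⟨b, x, hb, rfl⟩
    rw [SetLike.mem_coe, LinearMap.mem_ker]
    induction x using TensorProduct.induction_on with
    | zero => simp
    | tmul a v =>
      rw [smul_tmul_eq, LinearMap.rTensor_tmul, proj_mul, B.counit_eq_zero_of_mem hb, zero_smul,
        TensorProduct.zero_tmul]
    | add x y hx hy => rw [smul_add, map_add, hx, hy, add_zero]

/-- The map `A ⊗_B (A ⊗ V) → A ⊗ π_B(A) ⊗ V`, `a ⊗ a' ⊗ v ↦ a a'₍₁₎ ⊗ π_B(a'₍₂₎) ⊗ v`. -/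
def canFree : BalancedTensor B.toSubalgebra (A ⊗[ℂ] V) →ₗ[ℂ] A ⊗[ℂ] (B.Quot ⊗[ℂ] V) :=
  B.can (B.free V) (B.proj.rTensor V) (B.ker_proj_rTensor V)

theorem canFree_bijective : Function.Bijective (B.canFree V) :=
  B.can_bijective (F := B.free V) (B.ker_proj_rTensor V)
    (LinearMap.rTensor_surjective V (Submodule.mkQ_surjective B.plusIdeal))

variable {V}

/-- Written through the right coaction on `A`, so that the defining equation of the cotensor product
applies directly to the value. -/
theorem canFree_mk_tmul (a : A) (x : A ⊗[ℂ] V) :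
    B.canFree V ((balancingRelations B.toSubalgebra (A ⊗[ℂ] V)).mkQ (a ⊗ₜ x)) =
      a • TensorProduct.assoc ℂ A B.Quot V (B.rightCoact.rTensor V x) := by
  have e : (B.proj.rTensor V).lTensor A (freeLeft A V x) =
      TensorProduct.assoc ℂ A B.Quot V (B.rightCoact.rTensor V x) := by
    induction x using TensorProduct.induction_on with
    | zero => simp
    | tmul c v =>
      simp only [freeLeft, rightCoact, LinearMap.comp_apply, LinearMap.rTensor_tmul,
        LinearEquiv.coe_coe]
      induction Coalgebra.comul (R := ℂ) c using TensorProduct.induction_on with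
      | zero => simp
      | tmul x y => simp
      | add x y hx hy => simp only [TensorProduct.add_tmul, map_add, hx, hy]
    | add x y hx hy => simp only [map_add, hx, hy]
  rw [← e]
  exact B.can_mk_tmul (F := B.free V) (B.ker_proj_rTensor V) a x

/-- Coassociativity of the right `π_B(A)`-coaction on `A`: it follows from coassociativity of `Δ`
because `π_B` is a coalgebra map. -/
theorem assoc_rTensor_rightCoact_rightCoact (a : A) :
    TensorProduct.assoc ℂ A B.Quot B.Quot (B.rightCoact.rTensor B.Quot (B.rightCoact a)) =
      (Coalgebra.comul (R := ℂ) (A := B.Quot)).lTensor A (B.rightCoact a) := by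
  have e1 : ∀ y : A ⊗[ℂ] A, TensorProduct.assoc ℂ A B.Quot B.Quot
      (B.rightCoact.rTensor B.Quot (B.proj.lTensor A y)) =
      (TensorProduct.map B.proj B.proj).lTensor A (TensorProduct.assoc ℂ A A A
        ((Coalgebra.comul (R := ℂ) (A := A)).rTensor A y)) := by
    intro y
    induction y using TensorProduct.induction_on with
    | zero => simp
    | tmul a c =>
      simp only [LinearMap.lTensor_tmul, LinearMap.rTensor_tmul, rightCoact, LinearMap.comp_apply]
      induction Coalgebra.comul (R := ℂ) a using TensorProduct.induction_on with
      | zero => simp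
      | tmul x y => simp
      | add x y hx hy => simp only [TensorProduct.add_tmul, map_add, hx, hy]
    | add x y hx hy => simp only [map_add, hx, hy]
  have e2 : TensorProduct.map B.proj B.proj ∘ₗ Coalgebra.comul (R := ℂ) (A := A) =
      Coalgebra.comul (R := ℂ) (A := B.Quot) ∘ₗ B.proj := B.projCoalgHom.map_comp_comul
  rw [rightCoact, LinearMap.comp_apply, ← rightCoact, e1, Coalgebra.coassoc_apply,
    ← LinearMap.lTensor_comp_apply, e2, LinearMap.lTensor_comp_apply]

theorem assoc_rightCoact_rightCoact (x : A ⊗[ℂ] V) :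
    TensorProduct.assoc ℂ A B.Quot (B.Quot ⊗[ℂ] V) (B.rightCoact.rTensor (B.Quot ⊗[ℂ] V)
      (TensorProduct.assoc ℂ A B.Quot V (B.rightCoact.rTensor V x))) =
    (freeLeft B.Quot V).lTensor A
      (TensorProduct.assoc ℂ A B.Quot V (B.rightCoact.rTensor V x)) := by
  have e0 : ∀ (y : A ⊗[ℂ] B.Quot) (c : B.Quot) (v : V),
      TensorProduct.assoc ℂ A B.Quot (B.Quot ⊗[ℂ] V) (y ⊗ₜ (c ⊗ₜ v)) =
      (TensorProduct.assoc ℂ B.Quot B.Quot V).toLinearMap.lTensor A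
        (TensorProduct.assoc ℂ A (B.Quot ⊗[ℂ] B.Quot) V
          (TensorProduct.assoc ℂ A B.Quot B.Quot (y ⊗ₜ c) ⊗ₜ v)) := by
    intro y c v
    induction y using TensorProduct.induction_on with
    | zero => simp
    | tmul a c => simp
    | add x y hx hy => simp only [TensorProduct.add_tmul, map_add, hx, hy]
  have e1 : ∀ (y : A ⊗[ℂ] B.Quot) (v : V),
      TensorProduct.assoc ℂ A B.Quot (B.Quot ⊗[ℂ] V) (B.rightCoact.rTensor (B.Quot ⊗[ℂ] V)
        (TensorProduct.assoc ℂ A B.Quot V (y ⊗ₜ v))) =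
      (TensorProduct.assoc ℂ B.Quot B.Quot V).toLinearMap.lTensor A
        (TensorProduct.assoc ℂ A (B.Quot ⊗[ℂ] B.Quot) V
          (TensorProduct.assoc ℂ A B.Quot B.Quot (B.rightCoact.rTensor B.Quot y) ⊗ₜ v)) := by
    intro y v
    induction y using TensorProduct.induction_on with
    | zero => simp
    | tmul a c =>
      rw [TensorProduct.assoc_tmul, LinearMap.rTensor_tmul, LinearMap.rTensor_tmul, e0]
    | add x y hx hy => simp only [TensorProduct.add_tmul, map_add, hx, hy]
  have e2 : ∀ (y : A ⊗[ℂ] B.Quot) (v : V),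
      (freeLeft B.Quot V).lTensor A (TensorProduct.assoc ℂ A B.Quot V (y ⊗ₜ v)) =
      (TensorProduct.assoc ℂ B.Quot B.Quot V).toLinearMap.lTensor A
        (TensorProduct.assoc ℂ A (B.Quot ⊗[ℂ] B.Quot) V
          ((Coalgebra.comul (R := ℂ) (A := B.Quot)).lTensor A y ⊗ₜ v)) := by
    intro y v
    induction y using TensorProduct.induction_on with
    | zero => simp
    | tmul a c => simp [freeLeft]
    | add x y hx hy => simp only [TensorProduct.add_tmul, map_add, hx, hy]
  induction x using TensorProduct.induction_on with
  | zero => simp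
  | tmul a v => rw [LinearMap.rTensor_tmul, e1, e2, assoc_rTensor_rightCoact_rightCoact]
  | add x y hx hy => simp only [map_add, hx, hy]

theorem assoc_rightCoact_lTensor {W : Type*} [AddCommGroup W] [Module ℂ W] (γ : V →ₗ[ℂ] W)
    (x : A ⊗[ℂ] V) :
    TensorProduct.assoc ℂ A B.Quot W (B.rightCoact.rTensor W (γ.lTensor A x)) =
      (γ.lTensor B.Quot).lTensor A
        (TensorProduct.assoc ℂ A B.Quot V (B.rightCoact.rTensor V x)) := by
  induction x using TensorProduct.induction_on with
  | zero => simp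
  | tmul a v =>
    simp only [LinearMap.lTensor_tmul, LinearMap.rTensor_tmul]
    induction B.rightCoact a using TensorProduct.induction_on with
    | zero => simp
    | tmul x y => simp
    | add x y hx hy => simp only [TensorProduct.add_tmul, map_add, hx, hy]
  | add x y hx hy => simp only [map_add, hx, hy]

end Free

/-! ### The cotensor product after base change to `A` -/

section Cotensor

variable {V : Type u} [AddCommGroup V] [Module ℂ V] (l : V →ₗ[ℂ] B.Quot ⊗[ℂ] V)

/-- The `B`-linear map `A ⊗ V → A ⊗ π_B(A) ⊗ V` with kernel `A □_{π_B} V`. -/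
def psiDiff : A ⊗[ℂ] V →ₗ[B.toSubalgebra] A ⊗[ℂ] (B.Quot ⊗[ℂ] V) where
  toFun x := TensorProduct.assoc ℂ A B.Quot V (B.rightCoact.rTensor V x) - l.lTensor A x
  map_add' x y := by simp only [map_add]; abel
  map_smul' b x := by
    rw [rightCoact_rTensor_smul, assoc_smul, lTensor_smul]
    exact (smul_sub b _ _).symm

theorem exact_psiInclB_psiDiff : Function.Exact (B.psiInclB l) (B.psiDiff l) := by
  intro x
  refine sub_eq_zero.trans ((B.mem_psiSub_iff l x).symm.trans ?_)
  exact ⟨fun h => ⟨⟨x, h⟩, rfl⟩, fun ⟨y, hy⟩ => hy ▸ y.2⟩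

variable (V) in
/-- The map `A ⊗_B (A ⊗ V) → A ⊗ V`, `a ⊗ a' ⊗ v ↦ aa' ⊗ v`. -/
def mulMap : BalancedTensor B.toSubalgebra (A ⊗[ℂ] V) →ₗ[ℂ] A ⊗[ℂ] V :=
  (balancingRelations B.toSubalgebra (A ⊗[ℂ] V)).liftQ
    ((LinearMap.mul' ℂ A).rTensor V ∘ₗ (TensorProduct.assoc ℂ A A V).symm.toLinearMap) <| by
    rw [balancingRelations, Submodule.span_le]
    rintro _ ⟨a, b, x, rfl⟩
    rw [SetLike.mem_coe, LinearMap.mem_ker, map_sub, LinearMap.comp_apply, LinearMap.comp_apply,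
      LinearEquiv.coe_coe, mul'_rTensor_assoc_symm, mul'_rTensor_assoc_symm, mul_smul,
      Subalgebra.smul_def, sub_self]

theorem mulMap_mk_tmul (a : A) (x : A ⊗[ℂ] V) :
    B.mulMap V ((balancingRelations B.toSubalgebra (A ⊗[ℂ] V)).mkQ (a ⊗ₜ x)) = a • x :=
  mul'_rTensor_assoc_symm a x

/-- The map `A ⊗_B (A □_{π_B} V) → A ⊗ V`, `a ⊗ ∑ aᵢ ⊗ vᵢ ↦ ∑ a aᵢ ⊗ vᵢ`. -/
def psiMul : BalancedTensor B.toSubalgebra (B.psiSub l) →ₗ[ℂ] A ⊗[ℂ] V :=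
  B.mulMap V ∘ₗ BalancedTensor.map B.toSubalgebra (B.psiInclB l)

theorem psiMul_mk_tmul (a : A) (x : B.psiSub l) :
    B.psiMul l ((balancingRelations B.toSubalgebra (B.psiSub l)).mkQ (a ⊗ₜ x)) =
      a • B.psiIncl l x :=
  B.mulMap_mk_tmul a (B.psiIncl l x)

theorem balanced_induction {M : Type*} [AddCommGroup M] [Module ℂ M] [Module B.toSubalgebra M]
    [IsScalarTower ℂ B.toSubalgebra M] {N : Type*} [AddCommGroup N] [Module ℂ N]
    {f g : BalancedTensor B.toSubalgebra M →ₗ[ℂ] N}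
    (h : ∀ (a : A) (m : M), f ((balancingRelations B.toSubalgebra M).mkQ (a ⊗ₜ m)) =
      g ((balancingRelations B.toSubalgebra M).mkQ (a ⊗ₜ m))) : f = g := by
  apply Submodule.linearMap_qext
  exact TensorProduct.ext' h

/-- On `A □_C V` the right coaction of `A` may be traded for `l`, so `canFree` there is `a ⊗ x ↦ a ·
(id ⊗ l)(x)`. -/
theorem canFree_comp_psiInclB :
    B.canFree V ∘ₗ BalancedTensor.map B.toSubalgebra (B.psiInclB l) =
      l.lTensor A ∘ₗ B.psiMul l := by
  refine B.balanced_induction fun a x => ?_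
  rw [LinearMap.comp_apply, LinearMap.comp_apply, psiMul_mk_tmul, lTensor_left_smul]
  refine (B.canFree_mk_tmul a (B.psiIncl l x)).trans ?_
  exact congrArg _ ((B.mem_psiSub_iff l _).1 x.2)

/-- The first term of `psiDiff` becomes `id ⊗ Δ ⊗ id` by coassociativity of the right coaction on
`A`, the second becomes `id ⊗ id ⊗ l` by naturality. The base-changed difference is therefore `A`
tensored with a map that involves only `V`. -/
theorem canFree_comp_psiDiff :
    B.canFree (B.Quot ⊗[ℂ] V) ∘ₗ BalancedTensor.map B.toSubalgebra (B.psiDiff l) =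
      (freeLeft B.Quot V - l.lTensor B.Quot).lTensor A ∘ₗ B.canFree V := by
  refine B.balanced_induction fun a x => ?_
  rw [LinearMap.comp_apply, LinearMap.comp_apply, canFree_mk_tmul, lTensor_left_smul]
  refine (B.canFree_mk_tmul a (B.psiDiff l x)).trans ?_
  have e : B.psiDiff l x =
    TensorProduct.assoc ℂ A B.Quot V (B.rightCoact.rTensor V x) - l.lTensor A x := rfl
  rw [e, map_sub, map_sub, assoc_rightCoact_rightCoact, assoc_rightCoact_lTensor,
    LinearMap.lTensor_sub, LinearMap.sub_apply]

variable {l}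

/-- Injectivity: `(id ⊗ l) ∘ psiMul` is `canFree` after the base-changed inclusion, and both of
these are injective. Surjectivity: `(id ⊗ l)(y)` corresponds under `canFree` to an element killed by
the base-changed `psiDiff`, which by flatness comes from `A ⊗_B (A □_C V)`; then `id ⊗ l` is
cancelled. -/
theorem psiMul_bijective (h : IsLeftCoaction l) : Function.Bijective (B.psiMul l) := by
  have hl : Function.Injective (l.lTensor A) :=
    Module.Flat.lTensor_preserves_injective_linearMap _ (h.injective)
  have h1 := LinearMap.congr_fun (B.canFree_comp_psiInclB l)
  have h2 := LinearMap.congr_fun (B.canFree_comp_psiDiff l)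
  simp only [LinearMap.comp_apply] at h1 h2
  have hex := (B.faithfullyFlat (B.psiSub l) (A ⊗[ℂ] V) (A ⊗[ℂ] (B.Quot ⊗[ℂ] V))
    (B.psiInclB l) (B.psiDiff l)).1 (B.exact_psiInclB_psiDiff l)
  constructor
  · intro x y hxy
    refine (B.faithfullyFlat.injective_iff (B.psiInclB l)).2 (B.psiIncl_injective l)
      ((B.canFree_bijective V).1 ?_)
    rw [h1, h1, hxy]
  · intro y
    obtain ⟨z, hz⟩ := (B.canFree_bijective V).2 (l.lTensor A y)
    have hz0 : BalancedTensor.map B.toSubalgebra (B.psiDiff l) z = 0 := by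
      apply (B.canFree_bijective (B.Quot ⊗[ℂ] V)).1
      rw [h2, hz, map_zero, ← LinearMap.lTensor_comp_apply, LinearMap.sub_comp]
      -- Coassociativity of `l` says that `Δ ⊗ id - id ⊗ l` vanishes on the image of `l`.
      have e : freeLeft B.Quot V ∘ₗ l = l.lTensor B.Quot ∘ₗ l := h.coassoc
      rw [e, sub_self]
      simp
    obtain ⟨w, rfl⟩ := (hex z).1 hz0
    exact ⟨w, hl (by rw [← h1, hz])⟩

end Cotensor

/-! ### Unit and counit are bijective -/

section Equivalence

/-- The map `a ⊗ f ↦ a f₍₋₁₎ ⊗ [f₍₀₎]` from `A ⊗_B F` to `A ⊗ F / B⁺F` is bijective. -/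
theorem can_mkQ_bijective (F : RelHopfMod B) :
    Function.Bijective (B.can F (B.plusSMul F.carrier).mkQ (Submodule.ker_mkQ _)) :=
  B.can_bijective _ (Submodule.mkQ_surjective _)

theorem unitMap_bijective (F : RelHopfMod B) : Function.Bijective (B.unitMap F) := by
  refine (B.faithfullyFlat.bijective_iff (M := F.carrier) (N := B.psiSub (B.phiCoact F))
    (B.unitMap F)).1 ?_
  -- Both sides send `a ⊗ f` to `a f₍₋₁₎ ⊗ [f₍₀₎]`. With `psiMul` and `can` bijective, the
  -- base-changed unit must be bijective too.
  have h : B.psiMul (B.phiCoact F) ∘ₗ BalancedTensor.map B.toSubalgebra (B.unitMap F) =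
      B.can F (B.plusSMul F.carrier).mkQ (Submodule.ker_mkQ _) := by
    refine B.balanced_induction fun a f => ?_
    rw [can_mk_tmul]
    exact B.psiMul_mk_tmul _ a (B.unitMap F f)
  have hb : Function.Bijective (B.psiMul (B.phiCoact F)) :=
    B.psiMul_bijective (B.Phi.obj F).isLeftCoaction
  refine (Function.Bijective.of_comp_iff' hb _).1 ?_
  rw [← LinearMap.coe_comp, h]
  exact B.can_mkQ_bijective F

theorem lTensor_counitTensor_freeLeft {V : Type*} [AddCommGroup V] [Module ℂ V] (x : A ⊗[ℂ] V) :
    (counitTensor V).lTensor A (freeLeft A V x) = x := by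
  induction x using TensorProduct.induction_on with
  | zero => simp
  | tmul a v =>
    have k : ∀ z : A ⊗[ℂ] A, (counitTensor V).lTensor A (TensorProduct.assoc ℂ A A V (z ⊗ₜ v)) =
        TensorProduct.rid ℂ A ((Coalgebra.counit (R := ℂ) (A := A)).lTensor A z) ⊗ₜ v := by
      intro z
      induction z using TensorProduct.induction_on with
      | zero => simp
      | tmul a c => simp [counitTensor_tmul, TensorProduct.smul_tmul']
      | add x y hx hy => simp only [TensorProduct.add_tmul, map_add, hx, hy]
    refine (k _).trans ?_
    simp
  | add x y hx hy => simp only [map_add, hx, hy]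

/-- For `x = ∑ aᵢ ⊗ vᵢ` the left side is `∑ aᵢ₍₁₎ ⊗ ε(aᵢ₍₂₎) vᵢ = x`. This is the right triangle
identity, and it also computes the base-changed counit below. -/
theorem lTensor_counitMap_comp (V : LeftComod B.Quot) (x : (B.Psi.obj V).carrier) :
    (B.counitMap V).lTensor A ((B.plusSMul (B.Psi.obj V).carrier).mkQ.lTensor A
      ((B.Psi.obj V).coact x)) = B.psiObjIncl V x := by
  have h : B.counitMap V ∘ₗ (B.plusSMul (B.Psi.obj V).carrier).mkQ =
      counitTensor V.carrier ∘ₗ B.psiObjIncl V := rfl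
  rw [← LinearMap.lTensor_comp_apply, h, LinearMap.lTensor_comp_apply, psiObjIncl_coact,
    lTensor_counitTensor_freeLeft]

/-- The counit is a unital ring map to `ℂ`, so `1 ≠ 0` in `A`; hence `A` is faithfully flat over
`ℂ`. -/
theorem nontrivial_hopfAlgebra : Nontrivial A :=
  (Bialgebra.counitAlgHom ℂ A).toRingHom.domain_nontrivial

theorem counitMap_bijective (V : LeftComod B.Quot) : Function.Bijective (B.counitMap V) := by
  have := nontrivial_hopfAlgebra (A := A)
  -- Both sides send `a ⊗ x` to `a x`. Since `can` and `psiMul` are bijective, so is `id ⊗ C_V`.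
  have h : (B.counitMap V).lTensor A ∘ₗ B.can (B.Psi.obj V)
      (B.plusSMul (B.Psi.obj V).carrier).mkQ (Submodule.ker_mkQ _) = B.psiMul V.coact := by
    refine B.balanced_induction fun a x => ?_
    rw [LinearMap.comp_apply, can_mk_tmul, lTensor_left_smul, lTensor_counitMap_comp]
    exact (B.psiMul_mk_tmul _ a x).symm
  have hb : Function.Bijective ((B.counitMap V).lTensor A) := by
    rw [← Function.Bijective.of_comp_iff _ (B.can_mkQ_bijective (B.Psi.obj V)),
      ← LinearMap.coe_comp, h]
    exact B.psiMul_bijective V.isLeftCoaction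
  exact ⟨(Module.FaithfullyFlat.lTensor_injective_iff_injective ℂ A _).1 hb.1,
    (Module.FaithfullyFlat.lTensor_surjective_iff_surjective ℂ A _).1 hb.2⟩

end Equivalence

end QuantumHomogeneousSpace

/-! ### Compatibility with right coactions and the triangle identities -/

namespace QuantumHomogeneousSpace

variable {A : Type u} [Ring A] [HopfAlgebra ℂ A] (B : QuantumHomogeneousSpace A)
variable {D : Type u} [AddCommGroup D] [Module ℂ D] [Coalgebra ℂ D]

/-- Inside `A ⊗ Φ(F) ⊗ D` both sides are `f₍₋₁₎ ⊗ [f₍₀₎] ⊗ f₍₁₎`, which is unambiguous because the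
two coactions on `F` commute. The comparison is made there because `Ψ(Φ(F)) ⊗ D` embeds in it. -/
theorem unitMap_commR (F : RelHopfBimod B D) :
    B.psiCoactR (B.phiCoact F.toRelHopfMod) ((B.PhiR D).obj F).commute ∘ₗ
        (B.unitMap F.toRelHopfMod).restrictScalars ℂ =
      ((B.unitMap F.toRelHopfMod).restrictScalars ℂ).rTensor D ∘ₗ F.coactR := by
  have a1 := B.psiIncl_psiCoactR (B.phiCoact F.toRelHopfMod) ((B.PhiR D).obj F).commute
  have a3 := congrArg (LinearMap.rTensor D) (B.psiIncl_unitMap F.toRelHopfMod)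
  have a4 := B.psiIncl_unitMap F.toRelHopfMod
  have a5 := freeRight_lTensor A (B.plusSMul F.carrier).mkQ F.coactR (B.phiCoactR F)
    (B.phiCoactR_comp_mkQ F)
  have a6 := F.commute
  unfold CoactionsCommute at a6
  simp only [LinearMap.rTensor_comp, LinearMap.ext_iff, LinearMap.comp_apply,
    LinearEquiv.coe_coe] at a1 a3 a4 a5 a6
  refine LinearMap.ext fun x =>
    B.psiIncl_rTensor_injective (B.phiCoact F.toRelHopfMod) D ?_
  rw [LinearMap.comp_apply, LinearMap.comp_apply, a1, a3, a4]
  refine (a5 _).symm.trans ?_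
  rw [freeRight, LinearMap.comp_apply, ← a6, LinearEquiv.coe_coe, LinearEquiv.symm_apply_apply]

/-- `ε` acts on `A` and `r` on `V`, so they do not interact. Restricted to `A □_C V`, this is the
compatibility of the counit with the right coactions. -/
theorem rTensor_counitTensor_freeRight {V : Type*} [AddCommGroup V] [Module ℂ V]
    (r : V →ₗ[ℂ] V ⊗[ℂ] D) (y : A ⊗[ℂ] V) :
    (counitTensor V).rTensor D (freeRight A r y) = r (counitTensor V y) := by
  induction y using TensorProduct.induction_on with
  | zero => simp
  | tmul a v =>
    rw [counitTensor_tmul, map_smul, freeRight, LinearMap.comp_apply, LinearMap.lTensor_tmul,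
      LinearEquiv.coe_coe]
    induction r v using TensorProduct.induction_on with
    | zero => simp
    | tmul w d => simp [counitTensor_tmul, TensorProduct.smul_tmul']
    | add x y hx hy => simp only [TensorProduct.tmul_add, smul_add, map_add, hx, hy]
  | add x y hx hy => simp only [map_add, hx, hy]

theorem counitMap_commR (V : Bicomod B.Quot D) :
    V.coactR ∘ₗ B.counitMap V.toLeftComod =
      (B.counitMap V.toLeftComod).rTensor D ∘ₗ B.phiCoactR ((B.PsiR D).obj V) := by
  have h0 : B.counitMap V.toLeftComod ∘ₗ (B.plusSMul (B.Psi.obj V.toLeftComod).carrier).mkQ =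
      counitTensor V.carrier ∘ₗ B.psiObjIncl V.toLeftComod := rfl
  have h1 : (B.psiObjIncl V.toLeftComod).rTensor D ∘ₗ ((B.PsiR D).obj V).coactR =
      freeRight A V.coactR ∘ₗ B.psiObjIncl V.toLeftComod :=
    B.psiIncl_psiCoactR V.coact V.commute
  apply Submodule.linearMap_qext
  refine Eq.trans ?_ (congrArg ((B.counitMap V.toLeftComod).rTensor D ∘ₗ ·)
    (B.phiCoactR_comp_mkQ ((B.PsiR D).obj V))).symm
  refine LinearMap.ext fun x => ?_
  have h2 := LinearMap.congr_fun h1 x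
  have h3 : ∀ y : (B.Psi.obj V.toLeftComod).carrier ⊗[ℂ] D,
      (B.counitMap V.toLeftComod).rTensor D
        ((B.plusSMul (B.Psi.obj V.toLeftComod).carrier).mkQ.rTensor D y) =
      (counitTensor V.carrier).rTensor D ((B.psiObjIncl V.toLeftComod).rTensor D y) := fun y => by
    rw [← LinearMap.rTensor_comp_apply, h0, LinearMap.rTensor_comp_apply]
  refine Eq.trans ?_ (h3 _).symm
  refine Eq.trans ?_ (congrArg ((counitTensor V.carrier).rTensor D) h2).symm
  exact (rTensor_counitTensor_freeRight V.coactR _).symm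

variable (D) in
/-- Takeuchi's unit on relative Hopf modules with a right `D`-coaction. -/
def takUnitR : 𝟭 (RelHopfBimod B D) ⟶ B.PhiR D ⋙ B.PsiR D where
  app F :=
    { hom := B.takUnit.app F.toRelHopfMod
      commR := B.unitMap_commR F }
  naturality _ _ f := RelHopfBimod.Hom.ext (B.takUnit.naturality f.hom)

variable (D) in
/-- Takeuchi's counit on bicomodules. -/
def takCounitR : B.PsiR D ⋙ B.PhiR D ⟶ 𝟭 (Bicomod B.Quot D) where
  app V :=
    { hom := B.takCounit.app V.toLeftComod
      commR := B.counitMap_commR V }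
  naturality _ _ γ := Bicomod.Hom.ext (B.takCounit.naturality γ.hom)

/-- The left triangle identity: `ε(f₍₋₁₎)[f₍₀₎] = [f]` by counitality of the coaction on `F`. -/
theorem counitMap_phiMap_unitMap (F : RelHopfMod B) :
    B.counitMap (B.Phi.obj F) ∘ₗ B.phiMap (B.unitMap F) = LinearMap.id := by
  apply Submodule.linearMap_qext
  refine LinearMap.ext fun f => ?_
  change counitTensor _ ((B.plusSMul F.carrier).mkQ.lTensor A (F.coact f)) =
    (B.plusSMul F.carrier).mkQ f
  have e : ∀ y : A ⊗[ℂ] F.carrier,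
      counitTensor _ ((B.plusSMul F.carrier).mkQ.lTensor A y) =
        (B.plusSMul F.carrier).mkQ (TensorProduct.lid ℂ F.carrier
          ((Coalgebra.counit (R := ℂ) (A := A)).rTensor F.carrier y)) := by
    intro y
    induction y using TensorProduct.induction_on with
    | zero => simp
    | tmul a v => simp [counitTensor_tmul]
    | add x y hx hy => simp only [map_add, hx, hy]
  have hc := LinearMap.congr_fun F.isLeftCoaction.counit f
  rw [LinearMap.comp_apply] at hc
  rw [e, hc]
  simp

variable (D) in
/-- The adjunction between the lifts of Takeuchi's functors to bimodules and bicomodules. -/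
def adjR : B.PhiR D ⊣ B.PsiR D :=
  Adjunction.mkOfUnitCounit
    { unit := B.takUnitR D
      counit := B.takCounitR D
      left_triangle := by
        ext F
        simp only [NatTrans.comp_app, Functor.whiskerRight_app, Functor.whiskerLeft_app,
          Functor.associator_hom_app, Category.id_comp]
        apply Bicomod.Hom.ext
        apply LeftComod.Hom.ext
        exact B.counitMap_phiMap_unitMap F.toRelHopfMod
      right_triangle := by
        ext V
        simp only [NatTrans.comp_app, Functor.whiskerRight_app, Functor.whiskerLeft_app,
          Functor.associator_inv_app, Category.id_comp]
        apply RelHopfBimod.Hom.ext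
        apply RelHopfMod.Hom.ext
        refine LinearMap.ext fun x => Subtype.ext ?_
        exact B.lTensor_counitMap_comp V.toLeftComod x }

end QuantumHomogeneousSpace

/-! ### Bijective morphisms are isomorphisms -/

section Iso

variable {A : Type u} [Ring A] [HopfAlgebra ℂ A] {B : QuantumHomogeneousSpace A}
variable {C D : Type u} [AddCommGroup C] [Module ℂ C] [Coalgebra ℂ C]
  [AddCommGroup D] [Module ℂ D] [Coalgebra ℂ D]

theorem symm_lTensor_comm {M N E : Type*} [AddCommMonoid M] [Module ℂ M] [AddCommMonoid N]
    [Module ℂ N] [AddCommMonoid E] [Module ℂ E] (e : M ≃ₗ[ℂ] N) {ρ : M →ₗ[ℂ] E ⊗[ℂ] M}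
    {σ : N →ₗ[ℂ] E ⊗[ℂ] N} (h : σ ∘ₗ e.toLinearMap = e.toLinearMap.lTensor E ∘ₗ ρ) :
    ρ ∘ₗ e.symm.toLinearMap = e.symm.toLinearMap.lTensor E ∘ₗ σ := by
  have h1 : σ = e.toLinearMap.lTensor E ∘ₗ ρ ∘ₗ e.symm.toLinearMap := by
    rw [← LinearMap.comp_assoc, ← h, LinearMap.comp_assoc, LinearEquiv.comp_symm,
      LinearMap.comp_id]
  rw [h1, ← LinearMap.comp_assoc _ _ (e.symm.toLinearMap.lTensor E), ← LinearMap.lTensor_comp,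
    LinearEquiv.symm_comp, LinearMap.lTensor_id, LinearMap.id_comp]

theorem symm_rTensor_comm {M N E : Type*} [AddCommMonoid M] [Module ℂ M] [AddCommMonoid N]
    [Module ℂ N] [AddCommMonoid E] [Module ℂ E] (e : M ≃ₗ[ℂ] N) {ρ : M →ₗ[ℂ] M ⊗[ℂ] E}
    {σ : N →ₗ[ℂ] N ⊗[ℂ] E} (h : σ ∘ₗ e.toLinearMap = e.toLinearMap.rTensor E ∘ₗ ρ) :
    ρ ∘ₗ e.symm.toLinearMap = e.symm.toLinearMap.rTensor E ∘ₗ σ := by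
  have h1 : σ = e.toLinearMap.rTensor E ∘ₗ ρ ∘ₗ e.symm.toLinearMap := by
    rw [← LinearMap.comp_assoc, ← h, LinearMap.comp_assoc, LinearEquiv.comp_symm,
      LinearMap.comp_id]
  rw [h1, ← LinearMap.comp_assoc _ _ (e.symm.toLinearMap.rTensor E), ← LinearMap.rTensor_comp,
    LinearEquiv.symm_comp, LinearMap.rTensor_id, LinearMap.id_comp]

/-- The inverse linear map commutes with both coactions, by conjugating the two squares of `f`. -/
theorem Bicomod.isIso_of_bijective {V W : Bicomod C D} (f : V ⟶ W)
    (hf : Function.Bijective f.hom.map) : IsIso f := by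
  let e := LinearEquiv.ofBijective f.hom.map hf
  refine ⟨⟨⟨e.symm.toLinearMap, symm_lTensor_comm e f.hom.comm⟩,
    symm_rTensor_comm e f.commR⟩, ?_, ?_⟩
  · apply Bicomod.Hom.ext
    apply LeftComod.Hom.ext
    exact e.symm_comp
  · apply Bicomod.Hom.ext
    apply LeftComod.Hom.ext
    exact e.comp_symm

theorem RelHopfBimod.isIso_of_bijective {F G : RelHopfBimod B D} (f : F ⟶ G)
    (hf : Function.Bijective f.hom.map) : IsIso f := by
  let e := LinearEquiv.ofBijective f.hom.map hf
  -- The inverse must be `B`-linear, while the coaction squares are only `ℂ`-linear, so both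
  -- versions of the equivalence are kept.
  let e' := e.restrictScalars ℂ
  refine ⟨⟨⟨e.symm.toLinearMap, symm_lTensor_comm e' f.hom.comm⟩,
    symm_rTensor_comm e' f.commR⟩, ?_, ?_⟩
  · apply RelHopfBimod.Hom.ext
    apply RelHopfMod.Hom.ext
    exact e.symm_comp
  · apply RelHopfBimod.Hom.ext
    apply RelHopfMod.Hom.ext
    exact e.comp_symm

variable (B D)

theorem QuantumHomogeneousSpace.isIso_takUnitR : IsIso (B.takUnitR D) := by
  have : ∀ F, IsIso ((B.takUnitR D).app F) := fun F =>
    RelHopfBimod.isIso_of_bijective _ (B.unitMap_bijective F.toRelHopfMod)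
  exact NatIso.isIso_of_isIso_app _

theorem QuantumHomogeneousSpace.isIso_takCounitR : IsIso (B.takCounitR D) := by
  have : ∀ V, IsIso ((B.takCounitR D).app V) := fun V =>
    Bicomod.isIso_of_bijective _ (B.counitMap_bijective V.toLeftComod)
  exact NatIso.isIso_of_isIso_app _

end Iso

end NestedQHS

end

theorem mainTheorem5 {A : Type u} [Ring A] [HopfAlgebra ℂ A]
    (hS : Function.Bijective (HopfAlgebra.antipode ℂ (A := A)))
    (B P : NestedQHS.QuantumHomogeneousSpace A) (hBP : B.toSubalgebra ≤ P.toSubalgebra) :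
    -- `Φ` and `Ψ` lift Takeuchi's functors
    B.PhiR P.Quot ⋙ NestedQHS.Bicomod.forgetRight B.Quot P.Quot =
      NestedQHS.RelHopfBimod.forgetRight B P.Quot ⋙ B.Phi ∧
    B.PsiR P.Quot ⋙ NestedQHS.RelHopfBimod.forgetRight B P.Quot =
      NestedQHS.Bicomod.forgetRight B.Quot P.Quot ⋙ B.Psi ∧
    -- the components of Takeuchi's unit are right comodule maps
    (∀ F : NestedQHS.RelHopfBimod B P.Quot,
      ((B.PsiR P.Quot).obj ((B.PhiR P.Quot).obj F)).coactR ∘ₗ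
          (B.takUnit.app F.toRelHopfMod).map.restrictScalars ℂ =
        ((B.takUnit.app F.toRelHopfMod).map.restrictScalars ℂ).rTensor P.Quot ∘ₗ F.coactR) ∧
    -- the components of Takeuchi's counit are right comodule maps
    (∀ V : NestedQHS.Bicomod B.Quot P.Quot,
      V.coactR ∘ₗ (B.takCounit.app V.toLeftComod).map =
        (B.takCounit.app V.toLeftComod).map.rTensor P.Quot ∘ₗ
          ((B.PhiR P.Quot).obj ((B.PsiR P.Quot).obj V)).coactR) ∧
    -- with this unit and counit the lifted functors form an adjoint equivalence
    ∃ adj : B.PhiR P.Quot ⊣ B.PsiR P.Quot,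
      (∀ F : NestedQHS.RelHopfBimod B P.Quot,
        (adj.unit.app F).hom = B.takUnit.app F.toRelHopfMod) ∧
      (∀ V : NestedQHS.Bicomod B.Quot P.Quot,
        (adj.counit.app V).hom = B.takCounit.app V.toLeftComod) ∧
      IsIso adj.unit ∧ IsIso adj.counit :=
  -- The lifted functors, unit and counit contain the original ones as their underlying data, so
  -- compatibility with forgetting the right coaction holds by definition.
  ⟨rfl, rfl, B.unitMap_commR, B.counitMap_commR, B.adjR P.Quot, fun _ => rfl, fun _ => rfl,
    B.isIso_takUnitR P.Quot, B.isIso_takCounitR P.Quot⟩
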